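/- Let $q>2$ be an integer and $\beta>\beta_{\mathsf s}:=q$. For $n\ge 1$ let $\pi=\pi_{\beta,n}$ be the mean-field Potts measure on $\{1,\dots,q\}^n$, $$\pi(\sigma)\propto \exp\Big(-\frac{\beta}{n}\sum_{\{u,v\}}\mathbf 1\{\sigma(u)\ne\sigma(v)\}\Big),$$ where the sum is over the edges (unordered pairs) of the complete graph on $[n]$. The Glauber dynamics $(\sigma_t)_{t\ge 0}$ picks at each step a uniformly random vertex $v$ and resamples its spin from $\pi$ conditionally on the other spins, i.e. assigns it spin $k$ with probability proportional to $\exp(\frac{\beta}{n}\#\{u\ne v:\sigma(u)=k\})$. Let $S(\sigma)=(S_1(\sigma),\dots,S_q(\sigma))$ with $S_k(\sigma)=\frac1n\#\{v:\sigma(v)=k\}$ be the proportions vector. Let $m_{\mathsf r}$ be the unique root in $(1/q,1)$ of $$D_\beta(x)=\Big(1+(q-1)\exp\big(\beta\tfrac{1-qx}{q-1}\big)\Big)^{-1}-x .$$ For $i\in\{1,\dots,q\}$ let $s^{(i)}$ be the vector with $i$-th coordinate $m_{\mathsf r}$ and all other coordinates $\frac{1-m_{\mathsf r}}{q-1}$.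 For a sequence $r_n\to0$, let $\Omega_n^{\mathsf{ord},i}=\{\sigma:\|S(\sigma)-s^{(i)}\|_1\le r_n\}$, assumed non-empty for all large $n$, and let $\pi^{\mathsf{ord},i}=\pi(\,\cdot\mid\Omega_n^{\mathsf{ord},i})$. Then there are times $T=T(n)=O(n\log n)$ and a function $\mathrm{err}:\mathbb R\to\mathbb R$ with $\mathrm{err}(\gamma)\to0$ as $\gamma\to\infty$, both depending only on $\beta$ and $q$, such that for every spin $i$, every such sequence $(r_n)$ and every $\gamma>0$, the following holds for all sufficiently large $n$ (depending on $\beta,q,i,(r_n),\gamma$): for every configuration $\sigma_0$ with $S_i(\sigma_0)>S_j(\sigma_0)+\gamma n^{-1/2}$ for all $j\neq i$, $$\big\|\mathbb P_{\sigma_0}(S(\sigma_T)\in\cdot)-\mathbb P_{\pi^{\mathsf{ord},i}}(S(\sigma_T)\in\cdot)\big\|_{\mathrm{TV}}\le \mathrm{err}(\gamma),$$ where $\mathbb P_{\sigma_0}$ and $\mathbb P_{\pi^{\mathsf{ord},i}}$ denote the laws of the Glauber dynamics started from $\sigma_0$ and from $\pi^{\mathsf{ord},i}$, respectively. -/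

import Mathlib

open Filter Topology Asymptotics

namespace Potts

noncomputable section

/-- Spin configurations on the vertex set `Fin n` of the complete graph, with spins in `Fin q`. -/
abbrev Config (n q : ℕ) : Type := Fin n → Fin q

/-- The threshold `β_s = q`. -/
def betaS (q : ℕ) : ℝ := q

/-- The number of edges `{u, v}` of the complete graph on `Fin n` whose endpoints have
different spins (each unordered pair is counted once). -/
def disagreements {n q : ℕ} (σ : Config n q) : ℕ :=
  (Finset.univ.filter fun e : Fin n × Fin n => e.1 < e.2 ∧ σ e.1 ≠ σ e.2).card

/-- The unnormalized mean-field Potts weight. -/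
def weight {n q : ℕ} (β : ℝ) (σ : Config n q) : ℝ :=
  Real.exp (-(β / n) * (disagreements σ : ℝ))

/-- The mean-field Potts measure `π_β`. -/
def gibbs (n q : ℕ) (β : ℝ) (σ : Config n q) : ℝ :=
  weight β σ / ∑ τ : Config n q, weight β τ

/-- The proportions vector `S(σ)`. -/
def proportions {n q : ℕ} (σ : Config n q) (k : Fin q) : ℝ :=
  ((Finset.univ.filter fun v => σ v = k).card : ℝ) / n

/-- The number of vertices other than `v` with spin `k`. -/
def othersWithSpin {n q : ℕ} (σ : Config n q) (v : Fin n) (k : Fin q) : ℕ :=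
  (Finset.univ.filter fun u => u ≠ v ∧ σ u = k).card

/-- The conditional probability that vertex `v` has spin `k`, given the spins of all other
vertices in `σ`. -/
def resampleProb {n q : ℕ} (β : ℝ) (σ : Config n q) (v : Fin n) (k : Fin q) : ℝ :=
  Real.exp (β / n * (othersWithSpin σ v k : ℝ)) /
    ∑ l : Fin q, Real.exp (β / n * (othersWithSpin σ v l : ℝ))

/-- The transition matrix of the Glauber dynamics: choose a vertex uniformly at random and
resample its spin conditionally on the spins of the other vertices. -/
def glauber (n q : ℕ) (β : ℝ) : Matrix (Config n q) (Config n q) ℝ :=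
  fun σ τ => ∑ v : Fin n, ∑ k : Fin q,
    if τ = Function.update σ v k then (1 / (n : ℝ)) * resampleProb β σ v k else 0

/-- The law of `σ_t` when the Glauber dynamics is started from the law `ν`. -/
def lawAt {n q : ℕ} (β : ℝ) (ν : Config n q → ℝ) (t : ℕ) : Config n q → ℝ :=
  Matrix.vecMul ν (glauber n q β ^ t)

/-- The point mass at `σ`. -/
def pointMass {n q : ℕ} (σ : Config n q) : Config n q → ℝ := Pi.single σ 1

open Classical in
/-- The probability that the proportions vector lies in `A`, for a configuration of law `ν`. -/
def proportionsProb {n q : ℕ} (ν : Config n q → ℝ) (A : Set (Fin q → ℝ)) : ℝ :=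
  ∑ σ : Config n q, if proportions σ ∈ A then ν σ else 0

/-- The total-variation distance between the laws of the proportions vectors of configurations
of laws `ν` and `ν'`. -/
def proportionsTV {n q : ℕ} (ν ν' : Config n q → ℝ) : ℝ :=
  ⨆ A : Set (Fin q → ℝ), |proportionsProb ν A - proportionsProb ν' A|

/-- The one-dimensional drift function `D_β`. -/
def drift (q : ℕ) (β x : ℝ) : ℝ :=
  (1 + ((q : ℝ) - 1) * Real.exp (β * ((1 - q * x) / ((q : ℝ) - 1))))⁻¹ - x

/-- `m_r`, the largest root of `D_β` in `(1/q, 1)`; for `q > 2` and `β > q` there is exactly one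
root there. -/
def mr (q : ℕ) (β : ℝ) : ℝ :=
  sSup {x : ℝ | x ∈ Set.Ioo (1 / (q : ℝ)) 1 ∧ drift q β x = 0}

/-- The ordered point with `m_r` in coordinate `i` and `(1 - m_r) / (q - 1)` elsewhere. -/
def orderedPoint (q : ℕ) (β : ℝ) (i : Fin q) (k : Fin q) : ℝ :=
  if k = i then mr q β else (1 - mr q β) / ((q : ℝ) - 1)

/-- The ordered phase of spin `i` with radius `r`: the configurations whose proportions vector is
within `ℓ¹`-distance `r` of the ordered point. -/
def orderedPhase (n q : ℕ) (β : ℝ) (i : Fin q) (r : ℝ) : Set (Config n q) :=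
  {σ | ∑ k : Fin q, |proportions σ k - orderedPoint q β i k| ≤ r}

open Classical in
/-- The Potts measure conditioned on the ordered phase of spin `i` with radius `r`. -/
def gibbsOrdered (n q : ℕ) (β : ℝ) (i : Fin q) (r : ℝ) (σ : Config n q) : ℝ :=
  (if σ ∈ orderedPhase n q β i r then gibbs n q β σ else 0) /
    ∑ τ : Config n q, if τ ∈ orderedPhase n q β i r then gibbs n q β τ else 0

end

end Potts

/-!
Let spin `i` lead every other spin by at least `g = γ / √n`. While the smallest lead `x` is below a
level `a`, resampling has expected effect `(f (β x) - x) / n` on it, where `f = softmaxGap q`, and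
`f (β x) ≥ (1 + 4 c) x` on `[0, a]` because `β > q`. Hence the sum of the `P`-th inverse powers of
the leads is a Lyapunov function, and the dynamics lifts the lead from `γ / √n` to a constant in
time `O(n log n)`. The failure probability is of order `γ ^ (-P)`: a fixed `P` takes the lead up to
`n ^ (-1 / 4)`, and from there on `P` may be of order `√n`, which makes the failure probability
vanish. In the same way the lead does not fall back during a further time `O(n log n)`.

Once all leads exceed a level `b` at which `β f' (β b) < 1`, the single-site resampling
probabilities of two configurations can be coupled so that the expected Hamming distance contracts
by `1 - (1 - β f' (β b)) / n` per step, and two copies of the dynamics coalesce in time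
`O(n log n)`. As one can choose `b < a` for every `β > q`, the climb hands over to the coupling, so
any two initial laws under which `i` leads by `γ / √n` are merged up to an error of order
`γ ^ (-P)`. The ordered phase is one of them, since `1 / q < m_r`.
-/

namespace Potts

open scoped Matrix

section Softmax

variable {ι : Type*} [Fintype ι]

/-- The probability vector on `ι` proportional to `exp (x k)`. The single-site resampling
probabilities of the Glauber dynamics are of this form. -/
noncomputable def softmax (x : ι → ℝ) (k : ι) : ℝ := Real.exp (x k) / ∑ l, Real.exp (x l)

lemma sum_exp_pos [Nonempty ι] (x : ι → ℝ) : 0 < ∑ l, Real.exp (x l) :=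
  Finset.sum_pos (fun _ _ => Real.exp_pos _) Finset.univ_nonempty

lemma softmax_nonneg (x : ι → ℝ) (k : ι) : 0 ≤ softmax x k :=
  div_nonneg (Real.exp_pos _).le (Finset.sum_nonneg fun _ _ => (Real.exp_pos _).le)

lemma sum_softmax [Nonempty ι] (x : ι → ℝ) : ∑ k, softmax x k = 1 := by
  simp only [softmax, ← Finset.sum_div, div_self (sum_exp_pos x).ne']

lemma softmax_le_mul_exp_neg {x : ι → ℝ} {i j : ι} {y : ℝ} (h : y ≤ x i - x j) :
    softmax x j ≤ softmax x i * Real.exp (-y) := by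
  rw [softmax, softmax, div_mul_eq_mul_div, ← Real.exp_add]
  exact div_le_div_of_nonneg_right (Real.exp_le_exp.2 (by linarith))
    (Finset.sum_nonneg fun _ _ => (Real.exp_pos _).le)

lemma one_le_softmax_mul {x : ι → ℝ} {i : ι} {y : ℝ} (h : ∀ j, j ≠ i → y ≤ x i - x j) :
    1 ≤ softmax x i * (1 + ((Fintype.card ι : ℝ) - 1) * Real.exp (-y)) := by
  classical
  have : Nonempty ι := ⟨i⟩
  have hcard : ((Finset.univ.erase i).card : ℝ) = (Fintype.card ι : ℝ) - 1 := by
    rw [Finset.card_erase_of_mem (Finset.mem_univ i), Finset.card_univ,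
      Nat.cast_pred Fintype.card_pos]
  calc (1 : ℝ) = softmax x i + ∑ j ∈ Finset.univ.erase i, softmax x j := by
        rw [Finset.add_sum_erase _ _ (Finset.mem_univ i), sum_softmax]
    _ ≤ softmax x i + ∑ _j ∈ Finset.univ.erase i, softmax x i * Real.exp (-y) := by
        gcongr with j hj
        exact softmax_le_mul_exp_neg (h j (Finset.ne_of_mem_erase hj))
    _ = _ := by rw [Finset.sum_const, nsmul_eq_mul, hcard]; ring

lemma hasDerivAt_softmax {z : ℝ → ι → ℝ} {z' : ι → ℝ} {s : ℝ}
    (hz : ∀ k, HasDerivAt (fun s => z s k) (z' k) s) (k : ι) :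
    HasDerivAt (fun s => softmax (z s) k)
      (softmax (z s) k * (z' k - ∑ l, softmax (z s) l * z' l)) s := by
  have : Nonempty ι := ⟨k⟩
  have hpos := sum_exp_pos (z s)
  have hsum : ∑ l, softmax (z s) l * z' l =
      (∑ l, Real.exp (z s l) * z' l) / ∑ l, Real.exp (z s l) := by
    simp only [softmax, Finset.sum_div, div_mul_eq_mul_div]
  refine ((hz k).exp.div (HasDerivAt.fun_sum fun l _ => (hz l).exp) hpos.ne').congr_deriv ?_
  rw [hsum, softmax]
  field_simp

/-- The difference between the largest and the other coordinates of the softmax of a vector on `q`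
points whose largest coordinate exceeds all the others by exactly `y`. -/
noncomputable def softmaxGap (q y : ℝ) : ℝ :=
  (1 - Real.exp (-y)) / (1 + (q - 1) * Real.exp (-y))

/-- The derivative of `softmaxGap q` at `y`, as a function of `E = exp (-y)`. -/
noncomputable def softmaxGapSlope (q E : ℝ) : ℝ := q * E / (1 + (q - 1) * E) ^ 2

lemma one_add_mul_exp_pos {q : ℝ} (hq : 1 ≤ q) (y : ℝ) : 0 < 1 + (q - 1) * Real.exp y :=
  add_pos_of_pos_of_nonneg one_pos (mul_nonneg (sub_nonneg.2 hq) (Real.exp_pos y).le)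

@[simp] lemma softmaxGap_zero (q : ℝ) : softmaxGap q 0 = 0 := by simp [softmaxGap]

lemma softmaxGap_lt_one {q : ℝ} (hq : 1 ≤ q) (y : ℝ) : softmaxGap q y < 1 := by
  rw [softmaxGap, div_lt_one (one_add_mul_exp_pos hq _)]
  nlinarith [Real.exp_pos (-y)]

lemma softmaxGap_nonneg {q y : ℝ} (hq : 1 ≤ q) (hy : 0 ≤ y) : 0 ≤ softmaxGap q y :=
  div_nonneg (sub_nonneg.2 (Real.exp_le_one_iff.2 (neg_nonpos.2 hy))) (one_add_mul_exp_pos hq _).le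

lemma hasDerivAt_softmaxGap {q : ℝ} (hq : 1 ≤ q) (y : ℝ) :
    HasDerivAt (softmaxGap q) (softmaxGapSlope q (Real.exp (-y))) y := by
  have hE : HasDerivAt (fun y => Real.exp (-y)) (-Real.exp (-y)) y := by
    simpa using (hasDerivAt_neg y).exp
  refine ((hE.const_sub 1).div ((hE.const_mul (q - 1)).const_add 1)
    (one_add_mul_exp_pos hq (-y)).ne').congr_deriv ?_
  rw [softmaxGapSlope]
  congr 1
  ring

lemma softmaxGap_le_softmax_sub {x : ι → ℝ} {i j : ι} {y : ℝ} (hy : 0 ≤ y)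
    (h : ∀ k, k ≠ i → y ≤ x i - x k) (hj : j ≠ i) :
    softmaxGap (Fintype.card ι) y ≤ softmax x i - softmax x j := by
  have : Nonempty ι := ⟨i⟩
  have hq : (1 : ℝ) ≤ Fintype.card ι := Nat.one_le_cast.2 Fintype.card_pos
  have hE : 0 ≤ 1 - Real.exp (-y) := sub_nonneg.2 (Real.exp_le_one_iff.2 (by linarith))
  rw [softmaxGap, div_le_iff₀ (one_add_mul_exp_pos hq _)]
  have hi := mul_le_mul_of_nonneg_left (one_le_softmax_mul h) hE
  have hj := mul_le_mul_of_nonneg_right (softmax_le_mul_exp_neg (h j hj))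
    (one_add_mul_exp_pos hq (-y)).le
  linarith

/-- `g k * (1_S k - g(S))` is the covariance of the indicators of `k` and of `S` under `g`. -/
lemma covariance_sub_le_of_mem [DecidableEq ι] {g : ι → ℝ} (hg : g ∈ stdSimplex ℝ ι) {S : Finset ι}
    {i : ι} (hi : i ∈ S) {t : ℝ} (hgt : ∀ k, k ≠ i → g k ≤ t) (ht : t ≤ g i) (ht0 : 0 ≤ t)
    (k l : ι) :
    g k * ((if k ∈ S then 1 else 0) - ∑ j ∈ S, g j) -
      g l * ((if l ∈ S then 1 else 0) - ∑ j ∈ S, g j) ≤ g i * (1 - g i + t) := by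
  set p := ∑ j ∈ S, g j
  have hpi : g i ≤ p := Finset.single_le_sum (fun j _ => hg.1 j) hi
  have hp1 : p ≤ 1 :=
    (Finset.sum_le_univ_sum_of_nonneg hg.1).trans_eq hg.2
  have : 0 ≤ p := (hg.1 i).trans hpi
  have hki : g k ≤ g i := by
    by_cases h : k = i
    · rw [h]
    · exact (hgt k h).trans ht
  have hupper : g k * ((if k ∈ S then 1 else 0) - p) ≤ g i * (1 - p) := by
    split_ifs <;> nlinarith [hg.1 k]
  have hlower : -(t * p) ≤ g l * ((if l ∈ S then 1 else 0) - p) := by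
    split_ifs with hl
    · nlinarith [hg.1 l]
    · nlinarith [hgt l (by rintro rfl; exact hl hi)]
  nlinarith

lemma covariance_sub_le [DecidableEq ι] {g : ι → ℝ} (hg : g ∈ stdSimplex ℝ ι) (S : Finset ι)
    {i : ι} {t : ℝ} (hgt : ∀ k, k ≠ i → g k ≤ t) (ht : t ≤ g i) (ht0 : 0 ≤ t) (k l : ι) :
    g k * ((if k ∈ S then 1 else 0) - ∑ j ∈ S, g j) -
      g l * ((if l ∈ S then 1 else 0) - ∑ j ∈ S, g j) ≤ g i * (1 - g i + t) := by
  by_cases hi : i ∈ S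
  · exact covariance_sub_le_of_mem hg hi hgt ht ht0 k l
  -- Complementing `S` changes the sign of every covariance.
  have hcompl : ∀ k, g k * ((if k ∈ Sᶜ then 1 else 0) - ∑ j ∈ Sᶜ, g j) =
      -(g k * ((if k ∈ S then 1 else 0) - ∑ j ∈ S, g j)) := fun k => by
    rw [← sub_eq_of_eq_add' ((Finset.sum_add_sum_compl S g).trans hg.2).symm]
    by_cases hk : k ∈ S <;> simp only [Finset.mem_compl, hk, not_true, not_false_iff, if_true,
      if_false] <;> ring
  have := covariance_sub_le_of_mem hg (Finset.mem_compl.2 hi) hgt ht ht0 l k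
  rw [hcompl, hcompl] at this
  linarith

lemma sum_mul_le_of_sum_eq_zero {w c : ι → ℝ} {D : ℝ} (hw : ∑ k, w k = 0)
    (hc : ∀ k l, c k - c l ≤ D) : ∑ k, w k * c k ≤ D * (∑ k, |w k| / 2) := by
  rcases isEmpty_or_nonempty ι
  · simp
  obtain ⟨M, -, hM⟩ := Finset.univ.exists_max_image c Finset.univ_nonempty
  obtain ⟨m, -, hm⟩ := Finset.univ.exists_min_image c Finset.univ_nonempty
  calc ∑ k, w k * c k = ∑ k, w k * (c k - (c M + c m) / 2) := by
        simp only [mul_sub, Finset.sum_sub_distrib, ← Finset.sum_mul, hw]; ring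
    _ ≤ ∑ k, |w k| * (D / 2) := by
        refine Finset.sum_le_sum fun k _ => (le_abs_self _).trans ?_
        rw [abs_mul]
        refine mul_le_mul_of_nonneg_left (abs_le.2 ?_) (abs_nonneg _)
        constructor <;> linarith [hM k (Finset.mem_univ k), hm k (Finset.mem_univ k), hc M m]
    _ = D * (∑ k, |w k| / 2) := by rw [Finset.mul_sum]; congr! 1; ring

lemma softmax_mem_stdSimplex [Nonempty ι] (x : ι → ℝ) : softmax x ∈ stdSimplex ℝ ι :=
  ⟨softmax_nonneg x, sum_softmax x⟩

lemma softmax_covariance_sub_le [DecidableEq ι] {z : ι → ℝ} {i : ι} {b : ℝ}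
    (hz : ∀ j, j ≠ i → b ≤ z i - z j)
    (hb : ((Fintype.card ι : ℝ) + 1) * Real.exp (-b) ≤ 1) (S : Finset ι) (k l : ι) :
    softmax z k * ((if k ∈ S then 1 else 0) - ∑ j ∈ S, softmax z j) -
      softmax z l * ((if l ∈ S then 1 else 0) - ∑ j ∈ S, softmax z j) ≤
      softmaxGapSlope (Fintype.card ι) (Real.exp (-b)) := by
  have : Nonempty ι := ⟨i⟩
  have hq : (1 : ℝ) ≤ Fintype.card ι := Nat.one_le_cast.2 Fintype.card_pos
  have hE0 := Real.exp_pos (-b)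
  have hpos := one_add_mul_exp_pos hq (-b)
  have hu := one_le_softmax_mul hz
  have hE1 : Real.exp (-b) ≤ 1 := by nlinarith
  set E := Real.exp (-b)
  set u := softmax z i
  have hu0 : 0 ≤ u := softmax_nonneg z i
  refine (covariance_sub_le (softmax_mem_stdSimplex z) S (t := u * E)
    (fun k hk => softmax_le_mul_exp_neg (hz k hk)) (mul_le_of_le_one_right hu0 hE1)
    (by positivity) k l).trans ?_
  -- `u * (1 - (1 - E) * u)` decreases in `u` beyond the value attained when all gaps equal `b`.
  set u₀ := 1 / (1 + ((Fintype.card ι : ℝ) - 1) * E) with hu₀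
  have hu₀u : u₀ ≤ u := (div_le_iff₀ hpos).2 hu
  have hslope : softmaxGapSlope (Fintype.card ι) E = u₀ * (1 - (1 - E) * u₀) := by
    rw [softmaxGapSlope, hu₀, show (Fintype.card ι : ℝ) * E =
      (1 + ((Fintype.card ι : ℝ) - 1) * E) - (1 - E) by ring]
    field_simp [hpos.ne']
  have hhalf : 1 ≤ 2 * ((1 - E) * u₀) := by
    rw [hu₀, mul_one_div, mul_div_assoc', le_div_iff₀ hpos]
    linarith
  have hmono := mul_le_mul_of_nonneg_left hu₀u (sub_nonneg.2 hE1)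
  rw [hslope]
  nlinarith [mul_nonneg (sub_nonneg.2 hu₀u)
    (show 0 ≤ (1 - E) * u₀ + (1 - E) * u - 1 by linarith)]

lemma sum_softmax_sub_le {x y : ι → ℝ} {i : ι} {b : ℝ} (hx : ∀ j, j ≠ i → b ≤ x i - x j)
    (hy : ∀ j, j ≠ i → b ≤ y i - y j) (hb : ((Fintype.card ι : ℝ) + 1) * Real.exp (-b) ≤ 1)
    (hxy : ∑ k, x k = ∑ k, y k) (S : Finset ι) :
    ∑ k ∈ S, (softmax x k - softmax y k) ≤
      softmaxGapSlope (Fintype.card ι) (Real.exp (-b)) * (∑ k, |x k - y k| / 2) := by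
  classical
  set w : ι → ℝ := fun k => x k - y k with hw
  set z : ℝ → ι → ℝ := fun s k => y k + s * w k with hz
  have hw0 : ∑ k, w k = 0 := by simp [hw, hxy]
  have hderiv : ∀ s, HasDerivAt (fun s => ∑ k ∈ S, softmax (z s) k)
      (∑ k, w k * (softmax (z s) k *
        ((if k ∈ S then 1 else 0) - ∑ j ∈ S, softmax (z s) j))) s := fun s => by
    have hz' : ∀ k, HasDerivAt (fun s => z s k) (w k) s := fun k => by
      simpa only [one_mul] using ((hasDerivAt_id' s).mul_const (w k)).const_add (y k)
    refine (HasDerivAt.fun_sum fun k _ => hasDerivAt_softmax hz' k).congr_deriv ?_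
    simp only [mul_sub, Finset.sum_sub_distrib, mul_ite, mul_one, mul_zero, Finset.sum_ite_mem,
      Finset.univ_inter, ← Finset.sum_mul, ← mul_assoc]
    simp only [mul_comm]
  have hgap : ∀ s ∈ Set.Ioo (0 : ℝ) 1, ∀ j, j ≠ i → b ≤ z s i - z s j := fun s hs j hj => by
    simp only [hz, hw]
    nlinarith [hx j hj, hy j hj, hs.1, hs.2]
  have hmean := (convex_Icc (0 : ℝ) 1).image_sub_le_mul_sub_of_deriv_le
    (fun s _ => (hderiv s).continuousAt.continuousWithinAt)
    (fun s _ => (hderiv s).differentiableAt.differentiableWithinAt)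
    (fun s hs => (hderiv s).deriv.trans_le (sum_mul_le_of_sum_eq_zero hw0
      (softmax_covariance_sub_le (hgap s (by simpa using hs)) hb S)))
    0 (by simp) 1 (by simp) zero_le_one
  simpa [hz, hw] using hmean

end Softmax

section GapWindow

lemma exists_softmaxGapSlope_threshold {q β : ℝ} (hq : 3 ≤ q) (hβ : q < β) :
    ∃ E₀, 0 < E₀ ∧ (q + 1) * E₀ < 1 ∧
      (∀ E, E₀ < E → E ≤ 1 → 1 < β * softmaxGapSlope q E) ∧
      ∀ E, 0 < E → E < E₀ → β * softmaxGapSlope q E < 1 := by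
  set Q : ℝ → ℝ := fun E => (1 + (q - 1) * E) ^ 2 - β * (q * E) with hQ
  have hQ1 : Q 1 < 0 := by simp only [hQ]; nlinarith
  have hQend : Q (1 / (q + 1)) < 0 := by
    have : Q (1 / (q + 1)) = q * (4 * q - β * (q + 1)) / (q + 1) ^ 2 := by
      simp only [hQ]; field_simp; ring
    rw [this]
    exact div_neg_of_neg_of_pos (mul_neg_of_pos_of_neg (by linarith) (by nlinarith)) (by positivity)
  have hcont : ContinuousOn Q (Set.Icc 0 (1 / (q + 1))) := by fun_prop
  obtain ⟨E₀, ⟨hE₀, hE₀'⟩, hroot⟩ :=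
    intermediate_value_Ioo' (by positivity) hcont ⟨hQend, by simp [hQ]⟩
  rw [lt_div_iff₀' (by linarith)] at hE₀'
  have hE₀1 : E₀ < 1 := by nlinarith
  -- The second factor is linear in `E` and negative up to `E = 1`.
  have hfactor : ∀ E, (1 - E₀) * Q E =
      (E - E₀) * (Q 1 - (q - 1) ^ 2 * ((1 - E) * (1 - E₀))) := fun E => by
    simp only [hQ] at hroot ⊢
    linear_combination (1 - E) * hroot
  have hneg : ∀ E, E ≤ 1 → Q 1 - (q - 1) ^ 2 * ((1 - E) * (1 - E₀)) < 0 := fun E hE => by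
    have := mul_nonneg (sq_nonneg (q - 1)) (mul_nonneg (sub_nonneg.2 hE) (sub_nonneg.2 hE₀1.le))
    linarith
  have hsq : ∀ E, 0 < E → 0 < (1 + (q - 1) * E) ^ 2 := fun E hE =>
    pow_pos (by nlinarith) 2
  refine ⟨E₀, hE₀, hE₀', fun E hE hE1 => ?_, fun E hE0 hE => ?_⟩
  · have hQE : Q E < 0 := neg_of_mul_neg_right ((hfactor E).trans_lt
      (mul_neg_of_pos_of_neg (sub_pos.2 hE) (hneg E hE1))) (sub_pos.2 hE₀1).le
    rw [softmaxGapSlope, mul_div_assoc', one_lt_div (hsq E (hE₀.trans hE))]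
    simp only [hQ] at hQE
    linarith
  · have hQE : 0 < Q E := pos_of_mul_pos_right ((mul_pos_of_neg_of_neg (sub_neg.2 hE)
      (hneg E (hE.trans hE₀1).le)).trans_eq (hfactor E).symm) (sub_pos.2 hE₀1).le
    rw [softmaxGapSlope, mul_div_assoc', div_lt_one (hsq E hE0)]
    simp only [hQ] at hQE
    linarith

lemma exists_one_add_mul_le_of_one_lt_deriv {f : ℝ → ℝ} {x₀ : ℝ} (hx₀ : 0 < x₀)
    (hf : Differentiable ℝ f) (hf0 : f 0 = 0) (hderiv : ∀ x ∈ Set.Ico 0 x₀, 1 < deriv f x) :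
    ∃ a, x₀ < a ∧ ∃ c, 0 < c ∧ ∀ x ∈ Set.Icc 0 a, (1 + c) * x ≤ f x := by
  have hslope : ∀ x, x * dslope f 0 x = f x := fun x => by
    simpa [hf0] using sub_smul_dslope f 0 x
  have hgt : ∀ x ∈ Set.Icc 0 x₀, 1 < dslope f 0 x := by
    rintro x ⟨h0, hx⟩
    rcases h0.eq_or_lt with rfl | h0
    · exact dslope_same f 0 ▸ hderiv 0 ⟨le_rfl, hx₀⟩
    · obtain ⟨ξ, hξ, hmvt⟩ := exists_deriv_eq_slope f h0 hf.continuous.continuousOn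
        hf.differentiableOn
      rw [dslope_of_ne f h0.ne', slope_def_field, ← hmvt]
      exact hderiv ξ ⟨hξ.1.le, hξ.2.trans_le hx⟩
  have hcont : Continuous (dslope f 0) := continuousOn_univ.1
    ((continuousOn_dslope univ_mem).2 ⟨hf.continuous.continuousOn, hf 0⟩)
  obtain ⟨a, ha, hnear⟩ : ∃ a, x₀ < a ∧ ∀ x ∈ Set.Ico x₀ a, 1 < dslope f 0 x :=
    mem_nhdsGE_iff_exists_Ico_subset.1
      (mem_nhdsWithin_of_mem_nhds (hcont.tendsto x₀ (Ioi_mem_nhds (hgt x₀ ⟨hx₀.le, le_rfl⟩))))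
  obtain ⟨a', hxa', ha'⟩ := exists_between ha
  obtain ⟨y, hy, hmin⟩ := isCompact_Icc.exists_isMinOn
    (Set.nonempty_Icc.2 (hx₀.trans hxa').le) hcont.continuousOn
  have hy1 : 1 < dslope f 0 y := by
    rcases le_total y x₀ with h | h
    · exact hgt y ⟨hy.1, h⟩
    · exact hnear y ⟨h, hy.2.trans_lt ha'⟩
  refine ⟨a', hxa', dslope f 0 y - 1, sub_pos.2 hy1, fun x hx => ?_⟩
  rw [← hslope x, add_sub_cancel, mul_comm]
  exact mul_le_mul_of_nonneg_left (hmin hx) hx.1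

/-- An overlapping pair of ranges for the gaps between the proportion of a dominant spin and the
proportions of the other spins: as long as the smallest gap is at most `a` it is pushed upwards, at
a rate governed by `c`, and when all gaps are at least `b` the Glauber dynamics contracts. -/
structure IsGapWindow (q β b a c : ℝ) : Prop where
  b_pos : 0 < b
  b_lt_a : b < a
  c_pos : 0 < c
  c_le_one : c ≤ 1
  expansion : ∀ x ∈ Set.Icc 0 a, (1 + 4 * c) * x ≤ softmaxGap q (β * x)
  contraction : β * softmaxGapSlope q (Real.exp (-(β * b))) < 1
  exp_le : (q + 1) * Real.exp (-(β * b)) ≤ 1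

lemma exists_isGapWindow {q β : ℝ} (hq : 3 ≤ q) (hβ : q < β) :
    ∃ b a c, IsGapWindow q β b a c := by
  have hβ0 : 0 < β := by linarith
  obtain ⟨E₀, hE₀, hqE₀, habove, hbelow⟩ := exists_softmaxGapSlope_threshold hq hβ
  set x₀ := -Real.log E₀ / β with hx₀
  have hx₀pos : 0 < x₀ := div_pos (neg_pos.2 (Real.log_neg hE₀ (by nlinarith))) hβ0
  have hexp : Real.exp (-(β * x₀)) = E₀ := by
    rw [hx₀, mul_div_cancel₀ _ hβ0.ne', neg_neg, Real.exp_log hE₀]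
  have hderiv : ∀ x, HasDerivAt (fun x => softmaxGap q (β * x))
      (β * softmaxGapSlope q (Real.exp (-(β * x)))) x := fun x => by
    have h := (hasDerivAt_softmaxGap (by linarith : 1 ≤ q) (β * x)).comp x
      ((hasDerivAt_id' x).const_mul β)
    rwa [mul_one, mul_comm] at h
  obtain ⟨a, ha, c, hc, hexpand⟩ := exists_one_add_mul_le_of_one_lt_deriv hx₀pos
    (fun x => (hderiv x).differentiableAt) (by simp) fun x hx => by
      rw [(hderiv x).deriv]
      exact habove _ (hexp ▸ Real.exp_lt_exp.2 (by nlinarith [hx.2]))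
        (Real.exp_le_one_iff.2 (by nlinarith [hx.1]))
  obtain ⟨b, hb, hba⟩ := exists_between ha
  have hb' : Real.exp (-(β * b)) < E₀ := hexp ▸ Real.exp_lt_exp.2 (by nlinarith)
  refine ⟨b, a, min (c / 4) 1, hx₀pos.trans hb, hba, by positivity, min_le_right _ _,
    fun x hx => le_trans ?_ (hexpand x hx), hbelow _ (Real.exp_pos _) hb', ?_⟩
  · exact mul_le_mul_of_nonneg_right (by linarith [min_le_left (c / 4) 1]) hx.1
  · nlinarith

lemma IsGapWindow.lt_one {q β b a c : ℝ} (h : IsGapWindow q β b a c) (hq : 1 ≤ q) : a < 1 := by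
  nlinarith [h.expansion a ⟨(h.b_pos.trans h.b_lt_a).le, le_rfl⟩, softmaxGap_lt_one hq (β * a),
    h.b_pos, h.b_lt_a, h.c_pos]

lemma drift_eq_mul_softmaxGap_sub {q : ℕ} (hq : 1 < q) (β x : ℝ) :
    drift q β x = ((q : ℝ) - 1) / q *
      (softmaxGap q (β * ((q * x - 1) / (q - 1))) - (q * x - 1) / (q - 1)) := by
  have hq1 : (1 : ℝ) < q := Nat.one_lt_cast.2 hq
  have hm : (q : ℝ) - 1 ≠ 0 := (sub_pos.2 hq1).ne'
  have hpos := one_add_mul_exp_pos hq1.le (-(β * ((q * x - 1) / (q - 1))))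
  rw [drift, softmaxGap, show β * ((1 - q * x) / ((q : ℝ) - 1)) =
    -(β * ((q * x - 1) / (q - 1))) by ring]
  generalize Real.exp _ = E at hpos ⊢
  field_simp [hpos.ne']
  ring

lemma one_div_lt_mr {q : ℕ} (hq : 1 < q) {β a : ℝ} (ha0 : 0 < a) (ha1 : a < 1)
    (ha : a < softmaxGap q (β * a)) : 1 / (q : ℝ) < mr q β := by
  have hq1 : (1 : ℝ) < q := Nat.one_lt_cast.2 hq
  have hm : 0 < (q : ℝ) - 1 := sub_pos.2 hq1
  have hcoef : 0 < ((q : ℝ) - 1) / q := div_pos hm (by linarith)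
  set x : ℝ := (1 + (q - 1) * a) / q with hx
  have hxa : (q * x - 1) / (q - 1) = a := by rw [hx]; field_simp; ring
  have hx1 : x < 1 := by rw [hx, div_lt_one (by linarith)]; nlinarith
  have hqx : 1 / (q : ℝ) < x := by
    rw [hx]; exact div_lt_div_of_pos_right (by nlinarith) (by linarith)
  have hdrift_x : 0 < drift q β x := by
    rw [drift_eq_mul_softmaxGap_sub hq, hxa]
    exact mul_pos hcoef (sub_pos.2 ha)
  have hdrift_one : drift q β 1 < 0 := by
    rw [drift_eq_mul_softmaxGap_sub hq, mul_one, div_self hm.ne']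
    exact mul_neg_of_pos_of_neg hcoef (sub_neg.2 (softmaxGap_lt_one hq1.le _))
  have hcont : ContinuousOn (drift q β) (Set.Icc x 1) :=
    ((Continuous.inv₀ (by fun_prop) fun y => (one_add_mul_exp_pos hq1.le _).ne').sub
      continuous_id).continuousOn
  obtain ⟨y, hy, hroot⟩ := intermediate_value_Ioo' hx1.le hcont ⟨hdrift_one, hdrift_x⟩
  exact (hqx.trans hy.1).trans_le
    (le_csSup ⟨1, fun z hz => hz.1.2.le⟩ ⟨⟨hqx.trans hy.1, hy.2⟩, hroot⟩)

end GapWindow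

section Coupling

variable {α : Type*} [Fintype α]

/-- `p` is a nonnegative weight on pairs with marginals `μ` and `ν`, i.e. a coupling of `μ` and `ν`
when these are probability vectors. -/
structure IsCoupling (p : α → α → ℝ) (μ ν : α → ℝ) : Prop where
  nonneg : ∀ a b, 0 ≤ p a b
  sum_right : ∀ a, ∑ b, p a b = μ a
  sum_left : ∀ b, ∑ a, p a b = ν b

lemma isCoupling_mul {μ ν : α → ℝ} (hμ : μ ∈ stdSimplex ℝ α) (hν : ν ∈ stdSimplex ℝ α) :
    IsCoupling (fun a b => μ a * ν b) μ ν where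
  nonneg a b := mul_nonneg (hμ.1 a) (hν.1 b)
  sum_right a := by rw [← Finset.mul_sum, hν.2, mul_one]
  sum_left b := by rw [← Finset.sum_mul, hμ.2, one_mul]

lemma exists_isCoupling_sum_ne_le [DecidableEq α] {μ ν : α → ℝ} (hμ : 0 ≤ μ) (hν : 0 ≤ ν)
    (hsum : ∑ a, μ a = ∑ a, ν a) :
    ∃ p, IsCoupling p μ ν ∧
      ∃ S : Finset α, ∑ a, ∑ b, p a b * (if a ≠ b then 1 else 0) ≤ ∑ a ∈ S, (μ a - ν a) := by
  set e : α → ℝ := fun a => μ a - min (μ a) (ν a) with he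
  set e' : α → ℝ := fun a => ν a - min (μ a) (ν a) with he'
  set D : ℝ := ∑ a, e a
  have hD : ∑ a, e' a = D := by simp only [D, he, he', Finset.sum_sub_distrib, hsum]
  have he0 : ∀ a, 0 ≤ e a := fun a => sub_nonneg.2 (min_le_left _ _)
  have he'0 : ∀ a, 0 ≤ e' a := fun a => sub_nonneg.2 (min_le_right _ _)
  have hD0 : 0 ≤ D := Finset.sum_nonneg fun a _ => he0 a
  have hcancel : ∀ a, e a * D / D = e a := fun a => mul_div_cancel_of_imp fun h =>
    (Finset.sum_eq_zero_iff_of_nonneg fun a _ => he0 a).1 h a (Finset.mem_univ a)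
  have hcancel' : ∀ a, e' a * D / D = e' a := fun a => mul_div_cancel_of_imp fun h =>
    (Finset.sum_eq_zero_iff_of_nonneg fun a _ => he'0 a).1 (hD.trans h) a (Finset.mem_univ a)
  -- Keep the common mass `min μ ν` on the diagonal and couple the excesses independently.
  refine ⟨fun a b => (if a = b then min (μ a) (ν a) else 0) + e a * e' b / D,
    ⟨fun a b => ?_, fun a => ?_, fun b => ?_⟩, Finset.univ.filter fun a => ν a ≤ μ a, ?_⟩
  · refine add_nonneg ?_ (div_nonneg (mul_nonneg (he0 a) (he'0 b)) hD0)
    split_ifs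
    exacts [le_min (hμ a) (hν a), le_rfl]
  · rw [Finset.sum_add_distrib, ← Finset.sum_div, ← Finset.mul_sum, hD, hcancel]
    simp [he]
  · rw [Finset.sum_add_distrib, ← Finset.sum_div, ← Finset.sum_mul, mul_comm _ (e' b), hcancel']
    simp [he']
  · calc ∑ a, ∑ b, ((if a = b then min (μ a) (ν a) else 0) + e a * e' b / D) *
          (if a ≠ b then 1 else 0)
        ≤ ∑ a, ∑ b, e a * e' b / D := by
          refine Finset.sum_le_sum fun a _ => Finset.sum_le_sum fun b _ => ?_
          have := div_nonneg (mul_nonneg (he0 a) (he'0 b)) hD0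
          rcases eq_or_ne a b with rfl | h
          · simpa using this
          · simp [h]
      _ = ∑ a, e a := by
          simp only [← Finset.sum_div, ← Finset.mul_sum, hD, hcancel]
      _ = ∑ a ∈ Finset.univ.filter fun a => ν a ≤ μ a, (μ a - ν a) := by
          rw [Finset.sum_filter]
          refine Finset.sum_congr rfl fun a _ => ?_
          split_ifs with h
          · simp only [he, min_eq_right h]
          · simp only [he, min_eq_left (not_le.1 h).le, sub_self]

lemma IsCoupling.sum_mul_left {p : α → α → ℝ} {μ ν : α → ℝ} (hp : IsCoupling p μ ν) (f : α → ℝ) :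
    ∑ a, ∑ b, p a b * f a = μ ⬝ᵥ f := by
  simp only [← Finset.sum_mul, hp.sum_right, dotProduct]

lemma IsCoupling.sum_mul_right {p : α → α → ℝ} {μ ν : α → ℝ} (hp : IsCoupling p μ ν) (f : α → ℝ) :
    ∑ a, ∑ b, p a b * f b = ν ⬝ᵥ f := by
  rw [Finset.sum_comm]
  simp only [← Finset.sum_mul, hp.sum_left, dotProduct]

lemma IsCoupling.abs_dotProduct_sub_le {p : α → α → ℝ} {μ ν : α → ℝ} (hp : IsCoupling p μ ν)
    {f B : α → ℝ} {d : α → α → ℝ}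
    (hf : ∀ a b, p a b ≠ 0 → |f a - f b| ≤ d a b + B a + B b) :
    |μ ⬝ᵥ f - ν ⬝ᵥ f| ≤ ∑ a, ∑ b, p a b * d a b + μ ⬝ᵥ B + ν ⬝ᵥ B := by
  simp only [← hp.sum_mul_left, ← hp.sum_mul_right, ← Finset.sum_sub_distrib, ← mul_sub,
    ← Finset.sum_add_distrib, ← mul_add]
  refine (Finset.abs_sum_le_sum_abs _ _).trans (Finset.sum_le_sum fun a _ =>
    (Finset.abs_sum_le_sum_abs _ _).trans (Finset.sum_le_sum fun b _ => ?_))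
  rw [abs_mul, abs_of_nonneg (hp.nonneg a b)]
  rcases eq_or_ne (p a b) 0 with h | h
  · simp [h]
  · exact mul_le_mul_of_nonneg_left (hf a b h) (hp.nonneg a b)

lemma exists_isCoupling_mixture {V κ : Type*} [Fintype V] [Fintype κ] [DecidableEq α]
    {w : V → ℝ} (hw : 0 ≤ w) {p : V → κ → κ → ℝ} {μ ν : V → κ → ℝ}
    (hp : ∀ v, IsCoupling (p v) (μ v) (ν v)) (X Y : V → κ → α) :
    ∃ P, IsCoupling P
        (fun a => ∑ v, ∑ k, if a = X v k then w v * μ v k else 0)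
        (fun a => ∑ v, ∑ k, if a = Y v k then w v * ν v k else 0) ∧
      ∀ d : α → α → ℝ, ∑ a, ∑ b, P a b * d a b =
        ∑ v, w v * ∑ k, ∑ l, p v k l * d (X v k) (Y v l) := by
  refine ⟨fun a b => ∑ x : V × κ × κ,
    if a = X x.1 x.2.1 ∧ b = Y x.1 x.2.2 then w x.1 * p x.1 x.2.1 x.2.2 else 0,
    ⟨fun a b => ?_, fun a => ?_, fun b => ?_⟩, fun d => ?_⟩
  · refine Finset.sum_nonneg fun x _ => ?_
    split_ifs
    exacts [mul_nonneg (hw _) ((hp _).nonneg _ _), le_rfl]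
  · rw [Finset.sum_comm]
    simp only [Fintype.sum_prod_type, ite_and, ← (hp _).sum_right, Finset.mul_sum]
    refine Finset.sum_congr rfl fun v _ => Finset.sum_congr rfl fun k _ => ?_
    split_ifs <;> simp
  · rw [Finset.sum_comm]
    simp only [Fintype.sum_prod_type, and_comm (b := b = _), ite_and, ← (hp _).sum_left,
      Finset.mul_sum]
    refine Finset.sum_congr rfl fun v _ => ?_
    rw [Finset.sum_comm]
    refine Finset.sum_congr rfl fun k _ => ?_
    split_ifs <;> simp
  · simp only [Finset.sum_mul]
    simp_rw [Finset.sum_comm (s := Finset.univ (α := α)) (t := Finset.univ (α := V × κ × κ))]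
    simp [Fintype.sum_prod_type, ite_and, Finset.mul_sum, mul_assoc]

end Coupling

section MarkovChain

variable {α : Type*} [Fintype α] [DecidableEq α] {A : Matrix α α ℝ}

lemma mulVec_mono_of_mem_rowStochastic (hA : A ∈ Matrix.rowStochastic ℝ α) {f g : α → ℝ}
    (h : f ≤ g) : A *ᵥ f ≤ A *ᵥ g := fun _ =>
  dotProduct_le_dotProduct_of_nonneg_left h fun _ => Matrix.nonneg_of_mem_rowStochastic hA

lemma mulVec_smul_add_const (hA : A ∈ Matrix.rowStochastic ℝ α) (s u : ℝ) (f : α → ℝ) (x : α) :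
    (A *ᵥ fun y => s * f y + u) x = s * (A *ᵥ f) x + u := by
  have h : (fun y => s * f y + u) = s • f + u • 1 := by ext; simp
  rw [h, Matrix.mulVec_add, Matrix.mulVec_smul, Matrix.mulVec_smul,
    Matrix.one_vecMul_of_mem_rowStochastic hA]
  simp

lemma mulVec_mem_Icc_of_mem_rowStochastic (hA : A ∈ Matrix.rowStochastic ℝ α) {f : α → ℝ}
    (hf : f ∈ Set.Icc 0 1) : A *ᵥ f ∈ Set.Icc 0 1 :=
  ⟨(Matrix.mulVec_zero A).symm.trans_le (mulVec_mono_of_mem_rowStochastic hA hf.1),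
    (mulVec_mono_of_mem_rowStochastic hA hf.2).trans_eq
      (Matrix.one_vecMul_of_mem_rowStochastic hA)⟩

lemma row_mem_stdSimplex (hA : A ∈ Matrix.rowStochastic ℝ α) (x : α) : A x ∈ stdSimplex ℝ α :=
  ⟨fun _ => Matrix.nonneg_of_mem_rowStochastic hA, Matrix.sum_row_of_mem_rowStochastic hA x⟩

lemma pow_succ_mulVec (A : Matrix α α ℝ) (t : ℕ) (f : α → ℝ) :
    A ^ (t + 1) *ᵥ f = A *ᵥ (A ^ t *ᵥ f) := by
  rw [pow_succ', Matrix.mulVec_mulVec]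

lemma abs_mulVec_sub_le_of_mem_rowStochastic (hA : A ∈ Matrix.rowStochastic ℝ α) {f B : α → ℝ}
    {w : ℝ} (hf : ∀ x y, |f x - f y| ≤ w + B x + B y) (x y : α) :
    |(A *ᵥ f) x - (A *ᵥ f) y| ≤ w + (A *ᵥ B) x + (A *ᵥ B) y := by
  have hx := row_mem_stdSimplex hA x
  have hy := row_mem_stdSimplex hA y
  have h := (isCoupling_mul hx hy).abs_dotProduct_sub_le (d := fun _ _ => w) fun a b _ => hf a b
  simpa only [Matrix.mulVec, ← Finset.sum_mul, ← Finset.mul_sum, hx.2, hy.2, one_mul, mul_one]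
    using h

/-- `Ψ` is a Lyapunov function for the Markov chain `A` on the set `G`: its expectation contracts
by the factor `l` in one step from `G`, up to the additive error `e`. -/
structure DriftCondition (A : Matrix α α ℝ) (Ψ : α → ℝ) (G : Set α) (l e : ℝ) : Prop where
  nonneg : 0 ≤ Ψ
  rate_nonneg : 0 ≤ l
  rate_le_one : l ≤ 1
  error_nonneg : 0 ≤ e
  mulVec_le : ∀ x ∈ G, (A *ᵥ Ψ) x ≤ l * Ψ x + e

lemma DriftCondition.pow_mulVec_le {Ψ : α → ℝ} {G : Set α} {l e : ℝ}
    (hΨ : DriftCondition A Ψ G l e) (hA : A ∈ Matrix.rowStochastic ℝ α) {θ s u : ℝ} (hθ : 0 ≤ θ)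
    (hs : 0 ≤ s) (hu : 0 ≤ u) (hoff : ∀ x ∉ G, 1 ≤ θ * Ψ x) {f : α → ℝ} (hf : f ∈ Set.Icc 0 1)
    (hfΨ : ∀ x, f x ≤ s * Ψ x + u) (t : ℕ) (x : α) :
    (A ^ t *ᵥ f) x ≤ s * l ^ t * Ψ x + θ * Ψ x + t * ((s + θ) * e) + u := by
  have hΨ0 : ∀ x, 0 ≤ Ψ x := hΨ.nonneg
  have hl := hΨ.rate_nonneg
  have he := hΨ.error_nonneg
  induction t generalizing x with
  | zero => simpa using (hfΨ x).trans (by linarith [mul_nonneg hθ (hΨ0 x)])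
  | succ t ih =>
    have hΨx := hΨ0 x
    by_cases hx : x ∈ G
    · have hstep : (A ^ (t + 1) *ᵥ f) x ≤
          (s * l ^ t + θ) * (A *ᵥ Ψ) x + (t * ((s + θ) * e) + u) := by
        rw [pow_succ_mulVec, ← mulVec_smul_add_const hA]
        exact mulVec_mono_of_mem_rowStochastic hA (fun y => (ih y).trans_eq (by ring)) x
      have hdrift := mul_le_mul_of_nonneg_left (hΨ.mulVec_le x hx)
        (show 0 ≤ s * l ^ t + θ by positivity)
      have hθl : θ * (l * Ψ x) ≤ θ * Ψ x :=
        mul_le_mul_of_nonneg_left (mul_le_of_le_one_left hΨx hΨ.rate_le_one) hθ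
      have hsl : s * l ^ t * e ≤ s * e := mul_le_mul_of_nonneg_right
        (mul_le_of_le_one_right hs (pow_le_one₀ hl hΨ.rate_le_one)) he
      push_cast
      rw [pow_succ l]
      linarith
    · have hle : (A ^ (t + 1) *ᵥ f) x ≤ 1 :=
        (mulVec_mem_Icc_of_mem_rowStochastic (pow_mem hA (t + 1)) hf).2 x
      have := hoff x hx
      have : 0 ≤ s * l ^ (t + 1) * Ψ x := by positivity
      have : 0 ≤ ((t + 1 : ℕ) : ℝ) * ((s + θ) * e) := by positivity
      linarith

lemma DriftCondition.abs_pow_mulVec_sub_le {Ψ : α → ℝ} {G : Set α} {l e : ℝ}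
    (hΨ : DriftCondition A Ψ G l e) (hA : A ∈ Matrix.rowStochastic ℝ α) {θ : ℝ} (hθ : 0 ≤ θ)
    (hoff : ∀ x ∉ G, 1 ≤ θ * Ψ x) {d : α → α → ℝ} (hd : 0 ≤ d) {ρ : ℝ} (hρ : 0 ≤ ρ)
    (hcoupling : ∀ x ∈ G, ∀ y ∈ G,
      ∃ p, IsCoupling p (A x) (A y) ∧ ∑ a, ∑ b, p a b * d a b ≤ ρ * d x y)
    {f : α → ℝ} (hf : f ∈ Set.Icc 0 1) (hfd : ∀ x y, |f x - f y| ≤ d x y) (t : ℕ) (x y : α) :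
    |(A ^ t *ᵥ f) x - (A ^ t *ᵥ f) y| ≤
      ρ ^ t * d x y + (θ * Ψ x + t * (θ * e)) + (θ * Ψ y + t * (θ * e)) := by
  have hΨ0 : ∀ x, 0 ≤ θ * Ψ x := fun x => mul_nonneg hθ (hΨ.nonneg x)
  have he : 0 ≤ θ * e := mul_nonneg hθ hΨ.error_nonneg
  induction t generalizing x y with
  | zero =>
    simpa using (hfd x y).trans (by linarith [hΨ0 x, hΨ0 y])
  | succ t ih =>
    by_cases hxy : x ∈ G ∧ y ∈ G
    · obtain ⟨p, hp, hpd⟩ := hcoupling x hxy.1 y hxy.2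
      have hstep := hp.abs_dotProduct_sub_le fun a b _ => ih a b
      have hdist : ∑ a, ∑ b, p a b * (ρ ^ t * d a b) ≤ ρ ^ (t + 1) * d x y := by
        simp only [mul_left_comm (p _ _), ← Finset.mul_sum]
        rw [pow_succ, mul_assoc]
        exact mul_le_mul_of_nonneg_left hpd (pow_nonneg hρ t)
      have hpot : ∀ z ∈ G, (A *ᵥ fun z => θ * Ψ z + t * (θ * e)) z ≤
          θ * Ψ z + (t + 1 : ℕ) * (θ * e) := fun z hz => by
        rw [mulVec_smul_add_const hA]
        have := mul_le_mul_of_nonneg_left (hΨ.mulVec_le z hz) hθ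
        have := mul_le_mul_of_nonneg_right hΨ.rate_le_one (hΨ0 z)
        push_cast
        linarith
      rw [pow_succ_mulVec]
      exact hstep.trans (add_le_add (add_le_add hdist (hpot x hxy.1)) (hpot y hxy.2))
    · have hmem := mulVec_mem_Icc_of_mem_rowStochastic (pow_mem hA (t + 1)) hf
      have hle : |(A ^ (t + 1) *ᵥ f) x - (A ^ (t + 1) *ᵥ f) y| ≤ 1 :=
        abs_sub_le_of_nonneg_of_le (hmem.1 x) (hmem.2 x) (hmem.1 y) (hmem.2 y)
      have := mul_nonneg (pow_nonneg hρ (t + 1)) (hd x y)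
      have : 0 ≤ ((t + 1 : ℕ) : ℝ) * (θ * e) := by positivity
      rcases not_and_or.1 hxy with h | h <;> linarith [hoff _ h, hΨ0 x, hΨ0 y]

end MarkovChain

section Glauber

variable {n q : ℕ}

lemma resampleProb_eq_softmax (β : ℝ) (σ : Config n q) (v : Fin n) :
    resampleProb β σ v = softmax fun k => β / n * (othersWithSpin σ v k : ℝ) := rfl

lemma resampleProb_mem_stdSimplex (hq : 0 < q) (β : ℝ) (σ : Config n q) (v : Fin n) :
    resampleProb β σ v ∈ stdSimplex ℝ (Fin q) :=
  have : Nonempty (Fin q) := ⟨⟨0, hq⟩⟩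
  softmax_mem_stdSimplex _

lemma glauber_mulVec (β : ℝ) (f : Config n q → ℝ) (σ : Config n q) :
    (glauber n q β *ᵥ f) σ =
      ∑ v, 1 / (n : ℝ) * ∑ k, resampleProb β σ v k * f (Function.update σ v k) := by
  simp only [Matrix.mulVec, dotProduct, glauber, Finset.sum_mul]
  rw [Finset.sum_comm]
  refine Finset.sum_congr rfl fun v _ => ?_
  rw [Finset.sum_comm, Finset.mul_sum]
  simp [ite_mul, mul_assoc]

lemma glauber_mem_rowStochastic (hn : 0 < n) (hq : 0 < q) (β : ℝ) :
    glauber n q β ∈ Matrix.rowStochastic ℝ (Config n q) := by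
  refine Matrix.mem_rowStochastic.2 ⟨fun σ τ => ?_, ?_⟩
  · refine Finset.sum_nonneg fun v _ => Finset.sum_nonneg fun k _ => ?_
    split_ifs
    exacts [mul_nonneg (by positivity) ((resampleProb_mem_stdSimplex hq β σ v).1 k), le_rfl]
  · ext σ
    simp [glauber_mulVec, (resampleProb_mem_stdSimplex hq β σ _).2, hn.ne']

lemma sum_eq_sum_add_sub_of_forall_ne {ι M : Type*} [Fintype ι] [AddCommGroup M] {f g : ι → M}
    {v : ι} (h : ∀ u, u ≠ v → f u = g u) : ∑ u, f u = ∑ u, g u + (f v - g v) := by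
  rw [← sub_eq_iff_eq_add', ← Finset.sum_sub_distrib,
    Fintype.sum_eq_single v fun u hu => sub_eq_zero.2 (h u hu)]

lemma proportions_eq_sum (σ : Config n q) (k : Fin q) :
    proportions σ k = (∑ u, if σ u = k then (1 : ℝ) else 0) / n := by
  simp [proportions]

lemma othersWithSpin_div (σ : Config n q) (v : Fin n) (k : Fin q) :
    (othersWithSpin σ v k : ℝ) / n = proportions σ k - (if σ v = k then 1 else 0) / n := by
  have hsum : (othersWithSpin σ v k : ℝ) = ∑ u, if u ≠ v ∧ σ u = k then (1 : ℝ) else 0 := by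
    simp [othersWithSpin]
  rw [hsum, proportions_eq_sum, ← sub_div, sum_eq_sum_add_sub_of_forall_ne (v := v)
    (g := fun u => if σ u = k then (1 : ℝ) else 0) fun u hu => by simp [hu]]
  simp [sub_eq_add_neg]

lemma proportions_update (σ : Config n q) (v : Fin n) (k l : Fin q) :
    proportions (Function.update σ v k) l =
      proportions σ l + ((if k = l then 1 else 0) - (if σ v = l then 1 else 0)) / n := by
  rw [proportions_eq_sum, proportions_eq_sum, ← add_div, sum_eq_sum_add_sub_of_forall_ne (v := v)
    (g := fun u => if σ u = l then (1 : ℝ) else 0)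
    fun u hu => by rw [Function.update_of_ne hu], Function.update_self]

/-- The excess of the proportion of spin `i` over that of spin `j`. -/
noncomputable def gap (i j : Fin q) (σ : Config n q) : ℝ := proportions σ i - proportions σ j

lemma abs_gap_update_sub_le (σ : Config n q) (v : Fin n) (k i j : Fin q) :
    |gap i j (Function.update σ v k) - gap i j σ| ≤ 2 / n := by
  have hdiff : gap i j (Function.update σ v k) - gap i j σ =
      ((if k = i then 1 else 0) - (if σ v = i then 1 else 0) -
        ((if k = j then 1 else 0) - (if σ v = j then 1 else 0))) / n := by
    simp only [gap, proportions_update]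
    ring
  rw [hdiff, abs_div, Nat.abs_cast]
  refine div_le_div_of_nonneg_right ?_ n.cast_nonneg
  split_ifs <;> norm_num

lemma gap_sub_le_othersWithSpin (σ : Config n q) (v : Fin n) (i j : Fin q) :
    gap i j σ - 1 / n ≤ (othersWithSpin σ v i : ℝ) / n - (othersWithSpin σ v j : ℝ) / n := by
  rw [othersWithSpin_div, othersWithSpin_div, gap]
  have hi : (if σ v = i then (1 : ℝ) else 0) / n ≤ 1 / n := by gcongr; split_ifs <;> norm_num
  have hj : 0 ≤ (if σ v = j then (1 : ℝ) else 0) / n := by split_ifs <;> positivity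
  linarith

lemma glauber_mulVec_proportions (hn : 0 < n) (hq : 0 < q) (β : ℝ) (σ : Config n q) (l : Fin q) :
    (glauber n q β *ᵥ fun τ => proportions τ l) σ =
      proportions σ l + ((∑ v, resampleProb β σ v l) / n - proportions σ l) / n := by
  have hvertex : ∀ v, ∑ k, resampleProb β σ v k * proportions (Function.update σ v k) l =
      proportions σ l + (resampleProb β σ v l - (if σ v = l then 1 else 0)) / n := fun v => by
    simp only [proportions_update, mul_add, mul_div_assoc', mul_sub, Finset.sum_add_distrib,
      ← Finset.sum_div, Finset.sum_sub_distrib, ← Finset.sum_mul,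
      (resampleProb_mem_stdSimplex hq β σ v).2]
    simp
  simp only [glauber_mulVec, hvertex, ← Finset.mul_sum, Finset.sum_add_distrib, ← Finset.sum_div,
    Finset.sum_sub_distrib]
  rw [proportions_eq_sum]
  simp only [one_div, Finset.sum_boole, Finset.sum_const, Finset.card_univ, Fintype.card_fin,
    nsmul_eq_mul]
  field_simp

/-- The configurations in which spin `i` leads every other spin by at least `s`. -/
def leadSet (n : ℕ) (i : Fin q) (s : ℝ) : Set (Config n q) := {σ | ∀ j, j ≠ i → s ≤ gap i j σ}

lemma le_othersWithSpin_sub_of_mem_leadSet {i : Fin q} {s : ℝ} {σ : Config n q}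
    (hσ : σ ∈ leadSet n i (s + 1 / n)) (v : Fin n) {β : ℝ} (hβ : 0 ≤ β) {j : Fin q} (hj : j ≠ i) :
    β * s ≤ β / n * (othersWithSpin σ v i : ℝ) - β / n * (othersWithSpin σ v j : ℝ) := by
  rw [div_mul_eq_mul_div, div_mul_eq_mul_div, mul_div_assoc, mul_div_assoc, ← mul_sub]
  exact mul_le_mul_of_nonneg_left
    (by linarith [hσ j hj, gap_sub_le_othersWithSpin σ v i j]) hβ

lemma gap_add_le_glauber_mulVec_gap (hn : 0 < n) {β : ℝ} (hβ : 0 ≤ β) {i j : Fin q} (hj : j ≠ i)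
    {s : ℝ} (hs : 0 ≤ s) {σ : Config n q} (hσ : σ ∈ leadSet n i (s + 1 / n)) :
    gap i j σ + (softmaxGap q (β * s) - gap i j σ) / n ≤ (glauber n q β *ᵥ gap i j) σ := by
  have hn' : (0 : ℝ) < n := Nat.cast_pos.2 hn
  have hgap : (glauber n q β *ᵥ gap i j) σ =
      gap i j σ + ((∑ v, (resampleProb β σ v i - resampleProb β σ v j)) / n - gap i j σ) / n := by
    have hsub : gap i j = (fun τ : Config n q => proportions τ i) - fun τ => proportions τ j := rfl
    rw [hsub, Matrix.mulVec_sub, Pi.sub_apply, glauber_mulVec_proportions hn i.pos,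
      glauber_mulVec_proportions hn i.pos, Finset.sum_sub_distrib, Pi.sub_apply]
    ring
  have hsum : ∑ _v : Fin n, softmaxGap q (β * s) ≤
      ∑ v, (resampleProb β σ v i - resampleProb β σ v j) := by
    refine Finset.sum_le_sum fun v _ => ?_
    rw [resampleProb_eq_softmax]
    simpa using softmaxGap_le_softmax_sub (mul_nonneg hβ hs)
      (fun k hk => le_othersWithSpin_sub_of_mem_leadSet hσ v hβ hk) hj
  rw [hgap]
  gcongr
  rw [le_div_iff₀ hn']
  simpa [mul_comm] using hsum

end Glauber

section Hamming

variable {n q : ℕ}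

lemma hammingDist_eq_sum (σ σ' : Config n q) :
    (hammingDist σ σ' : ℝ) = ∑ u, if σ u ≠ σ' u then (1 : ℝ) else 0 := by
  simp only [hammingDist, Finset.card_filter, Nat.cast_sum, Nat.cast_ite, Nat.cast_one,
    Nat.cast_zero]

lemma hammingDist_update (σ σ' : Config n q) (v : Fin n) (k l : Fin q) :
    (hammingDist (Function.update σ v k) (Function.update σ' v l) : ℝ) =
      hammingDist σ σ' + ((if k ≠ l then 1 else 0) - (if σ v ≠ σ' v then 1 else 0)) := by
  rw [hammingDist_eq_sum, hammingDist_eq_sum, sum_eq_sum_add_sub_of_forall_ne (v := v)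
    (g := fun u => if σ u ≠ σ' u then (1 : ℝ) else 0) fun u hu => by
      rw [Function.update_of_ne hu, Function.update_of_ne hu], Function.update_self,
    Function.update_self]

lemma sum_othersWithSpin (σ : Config n q) (v : Fin n) : ∑ k, othersWithSpin σ v k = n - 1 := by
  simp only [othersWithSpin, Finset.card_filter]
  rw [Finset.sum_comm]
  simp [ite_and, Finset.sum_ite, Finset.filter_ne']

lemma sum_abs_othersWithSpin_sub_le (σ σ' : Config n q) (v : Fin n) :
    ∑ k, |(othersWithSpin σ v k : ℝ) - othersWithSpin σ' v k| ≤ 2 * hammingDist σ σ' := by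
  have habs : ∀ k, |(othersWithSpin σ v k : ℝ) - othersWithSpin σ' v k| ≤
      ∑ u, if σ u ≠ σ' u then (if σ u = k then (1 : ℝ) else 0) + (if σ' u = k then 1 else 0)
        else 0 := fun k => by
    simp only [othersWithSpin, Finset.card_filter, Nat.cast_sum, ← Finset.sum_sub_distrib]
    refine (Finset.abs_sum_le_sum_abs _ _).trans (Finset.sum_le_sum fun u _ => ?_)
    by_cases h : σ u = σ' u
    · simp [h]
    · by_cases hu : u = v <;> by_cases h1 : σ u = k <;> by_cases h2 : σ' u = k <;> simp_all
  refine (Finset.sum_le_sum fun k _ => habs k).trans_eq ?_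
  rw [Finset.sum_comm, hammingDist_eq_sum, Finset.mul_sum]
  refine Finset.sum_congr rfl fun u _ => ?_
  split_ifs
  · simp [Finset.sum_add_distrib, one_add_one_eq_two]
  · simp

lemma exists_isCoupling_resampleProb {β b : ℝ} (hβ : 0 ≤ β)
    (hb : ((q : ℝ) + 1) * Real.exp (-(β * b)) ≤ 1) {i : Fin q} {σ σ' : Config n q}
    (hσ : σ ∈ leadSet n i (b + 1 / n)) (hσ' : σ' ∈ leadSet n i (b + 1 / n)) (v : Fin n) :
    ∃ p, IsCoupling p (resampleProb β σ v) (resampleProb β σ' v) ∧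
      ∑ k, ∑ l, p k l * (if k ≠ l then 1 else 0) ≤
        β * softmaxGapSlope q (Real.exp (-(β * b))) * (hammingDist σ σ' / n) := by
  have hsimplex := fun τ : Config n q => resampleProb_mem_stdSimplex i.pos β τ v
  obtain ⟨p, hp, S, hS⟩ := exists_isCoupling_sum_ne_le (hsimplex σ).1 (hsimplex σ').1
    ((hsimplex σ).2.trans (hsimplex σ').2.symm)
  refine ⟨p, hp, hS.trans ?_⟩
  have hsum : ∀ τ : Config n q, ∑ k, β / n * (othersWithSpin τ v k : ℝ) = β / n * (n - 1 : ℕ) :=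
    fun τ => by rw [← Finset.mul_sum, ← Nat.cast_sum, sum_othersWithSpin]
  have hlip := sum_softmax_sub_le
    (fun j hj => le_othersWithSpin_sub_of_mem_leadSet hσ v hβ hj)
    (fun j hj => le_othersWithSpin_sub_of_mem_leadSet hσ' v hβ hj) (by simpa using hb)
    ((hsum σ).trans (hsum σ').symm) S
  simp only [resampleProb_eq_softmax, Fintype.card_fin] at hlip ⊢
  refine hlip.trans ?_
  have hslope : 0 ≤ softmaxGapSlope q (Real.exp (-(β * b))) := by
    unfold softmaxGapSlope; positivity
  calc softmaxGapSlope q (Real.exp (-(β * b))) *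
        (∑ k, |β / n * (othersWithSpin σ v k : ℝ) - β / n * (othersWithSpin σ' v k : ℝ)| / 2)
      = softmaxGapSlope q (Real.exp (-(β * b))) *
        (β / n * (∑ k, |(othersWithSpin σ v k : ℝ) - othersWithSpin σ' v k|) / 2) := by
        simp only [← mul_sub, abs_mul, abs_of_nonneg (div_nonneg hβ n.cast_nonneg),
          ← Finset.mul_sum, ← Finset.sum_div]
    _ ≤ softmaxGapSlope q (Real.exp (-(β * b))) * (β / n * (2 * hammingDist σ σ') / 2) := by
        gcongr
        exact sum_abs_othersWithSpin_sub_le σ σ' v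
    _ = β * softmaxGapSlope q (Real.exp (-(β * b))) * (hammingDist σ σ' / n) := by ring

lemma exists_isCoupling_glauber (hn : 0 < n) {β b : ℝ} (hβ : 0 ≤ β)
    (hb : ((q : ℝ) + 1) * Real.exp (-(β * b)) ≤ 1) {i : Fin q} {σ σ' : Config n q}
    (hσ : σ ∈ leadSet n i (b + 1 / n)) (hσ' : σ' ∈ leadSet n i (b + 1 / n)) :
    ∃ P, IsCoupling P (glauber n q β σ) (glauber n q β σ') ∧
      ∑ τ, ∑ τ', P τ τ' * hammingDist τ τ' ≤
        (1 - (1 - β * softmaxGapSlope q (Real.exp (-(β * b)))) / n) * hammingDist σ σ' := by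
  have hn' : (n : ℝ) ≠ 0 := Nat.cast_ne_zero.2 hn.ne'
  choose p hp hne using exists_isCoupling_resampleProb hβ hb hσ hσ'
  obtain ⟨P, hP, hexp⟩ := exists_isCoupling_mixture (w := fun _ => 1 / (n : ℝ))
    (fun _ => by positivity) hp (Function.update σ) (Function.update σ')
  refine ⟨P, hP, ?_⟩
  rw [hexp]
  have hvertex : ∀ v, ∑ k, ∑ l, p v k l *
      (hammingDist (Function.update σ v k) (Function.update σ' v l) : ℝ) ≤
      hammingDist σ σ' - (if σ v ≠ σ' v then 1 else 0) +
        β * softmaxGapSlope q (Real.exp (-(β * b))) * (hammingDist σ σ' / n) := fun v => by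
    have hmass : ∑ k, ∑ l, p v k l = 1 := by
      simp only [(hp v).sum_right, (resampleProb_mem_stdSimplex i.pos β σ v).2]
    simp only [hammingDist_update, mul_add, mul_sub, Finset.sum_add_distrib,
      Finset.sum_sub_distrib, ← Finset.sum_mul, hmass]
    linarith [hne v]
  calc _ ≤ ∑ v, 1 / (n : ℝ) * (hammingDist σ σ' - (if σ v ≠ σ' v then 1 else 0) +
        β * softmaxGapSlope q (Real.exp (-(β * b))) * (hammingDist σ σ' / n)) := by
        gcongr with v
        exact hvertex v
    _ = _ := by
        rw [← Finset.mul_sum, Finset.sum_add_distrib, Finset.sum_sub_distrib,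
          ← hammingDist_eq_sum]
        simp only [Finset.sum_const, Finset.card_univ, Fintype.card_fin, nsmul_eq_mul]
        field_simp
        ring

end Hamming

section Potential

variable {n q : ℕ}

/-- The potential that penalizes small leads of spin `i`: the sum of the `P`-th inverse powers of
the gaps. The truncation at `δ / 2` avoids division by zero and does not affect the one-step
transitions out of `leadSet n i δ`. -/
noncomputable def gapPot (i : Fin q) (δ : ℝ) (P : ℕ) (σ : Config n q) : ℝ :=
  ∑ j ∈ Finset.univ.erase i, (max (gap i j σ) (δ / 2))⁻¹ ^ P

lemma gapPot_nonneg (i : Fin q) {δ : ℝ} (hδ : 0 ≤ δ) (P : ℕ) (σ : Config n q) :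
    0 ≤ gapPot i δ P σ :=
  Finset.sum_nonneg fun _ _ =>
    pow_nonneg (inv_nonneg.2 (le_max_of_le_right (by positivity))) P

lemma one_le_pow_mul_gapPot {i : Fin q} {δ s : ℝ} (hδ : 0 < δ) (hs : δ / 2 ≤ s) (P : ℕ)
    {σ : Config n q} (hσ : σ ∉ leadSet n i s) : 1 ≤ s ^ P * gapPot i δ P σ := by
  obtain ⟨j, hj, hlt⟩ : ∃ j, j ≠ i ∧ gap i j σ < s := by simpa [leadSet] using hσ
  have hpos : ∀ l, 0 < max (gap i l σ) (δ / 2) := fun l => lt_max_of_lt_right (half_pos hδ)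
  have hs0 : 0 ≤ s := (half_pos hδ).le.trans hs
  calc 1 ≤ (s * (max (gap i j σ) (δ / 2))⁻¹) ^ P := one_le_pow₀ <| by
        rw [← div_eq_mul_inv, one_le_div (hpos j)]
        exact max_le hlt.le hs
    _ = s ^ P * (max (gap i j σ) (δ / 2))⁻¹ ^ P := mul_pow _ _ _
    _ ≤ s ^ P * gapPot i δ P σ := mul_le_mul_of_nonneg_left
        (Finset.single_le_sum (f := fun j => (max (gap i j σ) (δ / 2))⁻¹ ^ P)
          (fun l _ => pow_nonneg (inv_nonneg.2 (hpos l).le) P)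
          (Finset.mem_erase.2 ⟨hj, Finset.mem_univ j⟩)) (pow_nonneg hs0 P)

lemma card_erase_le (i : Fin q) : (Finset.univ.erase i).card ≤ q :=
  (Finset.card_le_univ _).trans_eq (Fintype.card_fin q)

lemma gapPot_le {i : Fin q} {δ s : ℝ} (hs : 0 < s) (P : ℕ) {σ : Config n q}
    (hσ : σ ∈ leadSet n i s) : gapPot i δ P σ ≤ q * s⁻¹ ^ P := by
  have hterm : ∀ j ∈ Finset.univ.erase i, (max (gap i j σ) (δ / 2))⁻¹ ^ P ≤ s⁻¹ ^ P :=
    fun j hj => by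
      have h : s ≤ max (gap i j σ) (δ / 2) := le_max_of_le_left (hσ j (Finset.ne_of_mem_erase hj))
      have := hs.trans_le h
      gcongr
  refine (Finset.sum_le_card_nsmul _ _ _ hterm).trans ?_
  rw [nsmul_eq_mul]
  exact mul_le_mul_of_nonneg_right (Nat.cast_le.2 (card_erase_le i)) (by positivity)

lemma inv_pow_le_of_abs_le {x y w : ℝ} {P : ℕ} (hx : 0 < x) (hy : 0 < y) (hw : w ≤ 1 / 2)
    (h : |P * ((y - x) / x)| ≤ w) :
    y⁻¹ ^ P ≤ x⁻¹ ^ P * (1 - P * ((y - x) / x) + 2 * w ^ 2) := by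
  set u := (y - x) / x with hu
  have hyx : y = x * (1 + u) := by rw [hu]; field_simp; ring
  have hu1 : -1 < u := by
    have := pos_of_mul_pos_right (hyx ▸ hy) hx.le
    linarith
  have hbernoulli : 1 + P * u ≤ (1 + u) ^ P := one_add_mul_le_pow (by linarith) P
  set v := P * u
  obtain ⟨hv, -⟩ := abs_le.1 h
  have hsq : v ^ 2 ≤ w ^ 2 := sq_le_sq' hv (abs_le.1 h).2
  rw [hyx, mul_inv, mul_pow, inv_pow (1 + u)]
  refine mul_le_mul_of_nonneg_left ?_ (by positivity)
  have hv0 : 0 < 1 + v := by linarith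
  calc ((1 + u) ^ P)⁻¹ ≤ (1 + v)⁻¹ := inv_anti₀ hv0 hbernoulli
    _ ≤ 1 - v + 2 * v ^ 2 := by
      rw [inv_eq_one_div, div_le_iff₀ hv0]
      nlinarith [mul_nonneg (sq_nonneg v) (by linarith : 0 ≤ 1 + 2 * v)]
    _ ≤ 1 - v + 2 * w ^ 2 := by linarith

/-- The exponents `P` and cutoffs `δ` for which `gapPot i δ P` is a Lyapunov function on
`leadSet n i δ` with rate `1 - c * (P / n)`: the first constraint lets the spins close to the
smallest gap outweigh the others, the second one controls the second-order Taylor remainder. -/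
structure IsPotentialScale (n q : ℕ) (c δ : ℝ) (P : ℕ) : Prop where
  exponent_pos : 1 ≤ P
  cutoff_pos : 0 < δ
  cutoff_le_one : δ ≤ 1
  card_mul_le : q * ((1 + 2 * c) * ((1 + 2 * c) / (1 + 3 * c)) ^ P) ≤ c
  exponent_le : 8 * P ≤ c * (n * δ ^ 2)

lemma IsPotentialScale.exponent_div_le {c δ : ℝ} {P : ℕ} (h : IsPotentialScale n q c δ P)
    (hn : 0 < n) (hc : 0 ≤ c) : 8 * (P / (n * δ)) ≤ c := by
  have hn' : (0 : ℝ) < n := Nat.cast_pos.2 hn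
  have hδ := h.cutoff_pos
  rw [mul_div_assoc', div_le_iff₀ (by positivity)]
  exact h.exponent_le.trans (mul_le_mul_of_nonneg_left (mul_le_mul_of_nonneg_left
    (pow_le_of_le_one hδ.le h.cutoff_le_one two_ne_zero) hn'.le) hc)

lemma IsPotentialScale.eight_div_le {c δ : ℝ} {P : ℕ} (h : IsPotentialScale n q c δ P)
    (hn : 0 < n) (hc : 0 ≤ c) : 8 / n ≤ c * δ := by
  have : (0 : ℝ) < n := Nat.cast_pos.2 hn
  have hδ := h.cutoff_pos
  calc (8 : ℝ) / n ≤ 8 * P / n := by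
        gcongr
        exact le_mul_of_one_le_right (by norm_num) (Nat.one_le_cast.2 h.exponent_pos)
    _ = 8 * (P / (n * δ)) * δ := by field_simp
    _ ≤ c * δ := by gcongr; exact h.exponent_div_le hn hc

lemma IsPotentialScale.one_div_le {c δ : ℝ} {P : ℕ} (h : IsPotentialScale n q c δ P)
    (hn : 0 < n) (hc0 : 0 ≤ c) (hc1 : c ≤ 1) : 1 / n ≤ δ := by
  have hle : (1 : ℝ) / n ≤ 8 / n := by
    gcongr
    norm_num
  exact hle.trans ((h.eight_div_le hn hc0).trans (mul_le_of_le_one_left h.cutoff_pos.le hc1))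

lemma max_gap_update_inv_pow_le (hn : 0 < n) {c δ : ℝ} (hc0 : 0 ≤ c) (hc1 : c ≤ 1) {P : ℕ}
    (hP : IsPotentialScale n q c δ P) {i j : Fin q} {σ : Config n q} (hσ : δ ≤ gap i j σ)
    (v : Fin n) (k : Fin q) :
    (max (gap i j (Function.update σ v k)) (δ / 2))⁻¹ ^ P ≤ (gap i j σ)⁻¹ ^ P *
      (1 - P * ((gap i j (Function.update σ v k) - gap i j σ) / gap i j σ) + c * (P / n)) := by
  have : (0 : ℝ) < n := Nat.cast_pos.2 hn
  have hδ := hP.cutoff_pos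
  have hΔ := abs_gap_update_sub_le σ v k i j
  set x := gap i j σ
  set y := gap i j (Function.update σ v k)
  have hx : 0 < x := hδ.trans_le hσ
  have hn8 := hP.eight_div_le hn hc0
  have hy : δ / 2 ≤ y := by
    have h28 : (2 : ℝ) / n = 8 / n / 4 := by ring
    nlinarith [(abs_le.1 hΔ).1]
  have hw := hP.exponent_div_le hn hc0
  have hrel : |P * ((y - x) / x)| ≤ P * (2 / (n * δ)) := by
    rw [abs_mul, Nat.abs_cast, abs_div, abs_of_pos hx, ← div_div]
    gcongr
  rw [max_eq_left hy]
  refine (inv_pow_le_of_abs_le hx (by linarith) (by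
    rw [mul_div_assoc', mul_comm, mul_div_assoc]; linarith) hrel).trans ?_
  have hsq : 2 * (P * (2 / (n * δ))) ^ 2 ≤ c * (P / n) := by
    calc 2 * (P * (2 / (n * δ))) ^ 2 = P / n * (8 * P / (n * δ ^ 2)) := by field_simp; ring
      _ ≤ P / n * c := by
        gcongr
        rw [div_le_iff₀ (by positivity)]
        exact hP.exponent_le
      _ = c * (P / n) := mul_comm _ _
  gcongr

lemma glauber_mulVec_le_of_forall_update (hq : 0 < q) (β : ℝ) {f g : Config n q → ℝ}
    {σ : Config n q} (h : ∀ v k, f (Function.update σ v k) ≤ g (Function.update σ v k)) :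
    (glauber n q β *ᵥ f) σ ≤ (glauber n q β *ᵥ g) σ := by
  rw [glauber_mulVec, glauber_mulVec]
  gcongr with v _ k
  exacts [(resampleProb_mem_stdSimplex hq β σ v).1 k, h v k]

lemma glauber_mulVec_max_gap_inv_pow_le (hn : 0 < n) {β c δ h : ℝ} (hc0 : 0 ≤ c) (hc1 : c ≤ 1)
    {P : ℕ} (hP : IsPotentialScale n q c δ P) {i j : Fin q} {σ : Config n q} (hσ : δ ≤ gap i j σ)
    (hh : gap i j σ + (h - gap i j σ) / n ≤ (glauber n q β *ᵥ gap i j) σ) :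
    (glauber n q β *ᵥ fun τ => (max (gap i j τ) (δ / 2))⁻¹ ^ P) σ ≤
      (gap i j σ)⁻¹ ^ P * (1 + c * (P / n) - P / n * (h / gap i j σ - 1)) := by
  have hx : 0 < gap i j σ := hP.cutoff_pos.trans_le hσ
  have hupdate := fun v k => max_gap_update_inv_pow_le hn hc0 hc1 hP hσ v k
  set x := gap i j σ
  set s : ℝ := -(x⁻¹ ^ P * (P / x)) with hs
  set u : ℝ := x⁻¹ ^ P * (1 + P + c * (P / n)) with hu
  calc (glauber n q β *ᵥ fun τ => (max (gap i j τ) (δ / 2))⁻¹ ^ P) σ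
      ≤ (glauber n q β *ᵥ fun τ => s * gap i j τ + u) σ :=
        glauber_mulVec_le_of_forall_update i.pos β fun v k => (hupdate v k).trans_eq <| by
          rw [hs, hu, sub_div, div_self hx.ne']
          ring
    _ = s * (glauber n q β *ᵥ gap i j) σ + u :=
        mulVec_smul_add_const (glauber_mem_rowStochastic hn i.pos β) s u _ σ
    _ ≤ s * (x + (h - x) / n) + u := by
        have hs0 : s ≤ 0 := neg_nonpos.2 (by positivity)
        linarith [mul_le_mul_of_nonpos_left hh hs0]
    _ = x⁻¹ ^ P * (1 + c * (P / n) - P / n * (h / x - 1)) := by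
        rw [hs, hu]
        field_simp
        ring

lemma sum_inv_pow_mul_nonneg {ι : Type*} {s : Finset ι} {x : ι → ℝ} {m : ι} (hm : m ∈ s)
    (hx : 0 < x m) (hmin : ∀ j ∈ s, x m ≤ x j) {u v : ℝ} (hu : 0 ≤ u) (hv : 0 < v) {P : ℕ}
    (hP : s.card * (u * (u / v) ^ P) ≤ v - u) :
    0 ≤ ∑ j ∈ s, (x j)⁻¹ ^ P * (v * (x m / x j) - u) := by
  classical
  have hterm : ∀ j ∈ s, -(u * (u / v) ^ P * (x m)⁻¹ ^ P) ≤
      (x j)⁻¹ ^ P * (v * (x m / x j) - u) := fun j hj => by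
    have hxj : 0 < x j := hx.trans_le (hmin j hj)
    rcases le_total (u / v) (x m / x j) with h | h
    · have : 0 ≤ v * (x m / x j) - u := by
        rw [div_le_iff₀' hv] at h
        linarith
      exact (neg_nonpos.2 (by positivity)).trans (by positivity)
    · have hpow : (x j)⁻¹ ^ P ≤ (u / v) ^ P * (x m)⁻¹ ^ P := by
        rw [← mul_pow]
        gcongr
        rw [← div_eq_mul_inv, le_div_iff₀ hx, inv_mul_eq_div]
        exact h
      have h1 := mul_le_mul_of_nonneg_left hpow hu
      have h2 : 0 ≤ (x j)⁻¹ ^ P * (v * (x m / x j)) := by positivity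
      linarith
  have hrest := Finset.card_nsmul_le_sum (s.erase m) _ _
    fun j hj => hterm j (Finset.mem_of_mem_erase hj)
  have hcard : ((s.erase m).card : ℝ) ≤ s.card := by exact_mod_cast Finset.card_erase_le
  have hψ : 0 ≤ (x m)⁻¹ ^ P := by positivity
  have h1 := mul_le_mul_of_nonneg_right hP hψ
  have h2 := mul_le_mul_of_nonneg_right hcard (by positivity : 0 ≤ u * (u / v) ^ P * (x m)⁻¹ ^ P)
  rw [← Finset.add_sum_erase _ _ hm, div_self hx.ne']
  rw [nsmul_eq_mul] at hrest
  linarith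

lemma sum_inv_pow_mul_le_of_expansion {ι : Type*} {s : Finset ι} {x : ι → ℝ} {m : ι} (hm : m ∈ s)
    (hx : 0 < x m) (hmin : ∀ j ∈ s, x m ≤ x j) {c w h : ℝ} (hc : 0 ≤ c) (hw : 0 ≤ w)
    (hh : (1 + 3 * c) * x m ≤ h) {P : ℕ}
    (hP : s.card * ((1 + 2 * c) * ((1 + 2 * c) / (1 + 3 * c)) ^ P) ≤ c) :
    ∑ j ∈ s, (x j)⁻¹ ^ P * (1 + c * w - w * (h / x j - 1)) ≤
      (1 - c * w) * ∑ j ∈ s, (x j)⁻¹ ^ P := by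
  have hsum := sum_inv_pow_mul_nonneg hm hx hmin (u := 1 + 2 * c) (v := 1 + 3 * c)
    (by positivity) (by positivity) (hP.trans_eq (by ring))
  calc ∑ j ∈ s, (x j)⁻¹ ^ P * (1 + c * w - w * (h / x j - 1))
      ≤ ∑ j ∈ s, ((1 - c * w) * (x j)⁻¹ ^ P -
          w * ((x j)⁻¹ ^ P * ((1 + 3 * c) * (x m / x j) - (1 + 2 * c)))) := by
        refine Finset.sum_le_sum fun j hj => ?_
        have hxj : 0 < x j := hx.trans_le (hmin j hj)
        have hdiv : (1 + 3 * c) * (x m / x j) ≤ h / x j := by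
          rw [mul_div_assoc']
          gcongr
        have := mul_le_mul_of_nonneg_left hdiv (by positivity : 0 ≤ w * (x j)⁻¹ ^ P)
        linarith
    _ ≤ (1 - c * w) * ∑ j ∈ s, (x j)⁻¹ ^ P := by
        rw [Finset.sum_sub_distrib, ← Finset.mul_sum, ← Finset.mul_sum]
        linarith [mul_nonneg hw hsum]

lemma sum_inv_pow_mul_le_of_le {ι : Type*} {s : Finset ι} {x : ι → ℝ} {a : ℝ} (ha : 0 < a)
    (hx : ∀ j ∈ s, a ≤ x j) {c w h : ℝ} (hc1 : c ≤ 1) (hw : 0 ≤ w) (hh : 0 ≤ h)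
    (P : ℕ) :
    ∑ j ∈ s, (x j)⁻¹ ^ P * (1 + c * w - w * (h / x j - 1)) ≤
      (1 - c * w) * ∑ j ∈ s, (x j)⁻¹ ^ P + 3 * s.card * w * a⁻¹ ^ P := by
  calc ∑ j ∈ s, (x j)⁻¹ ^ P * (1 + c * w - w * (h / x j - 1))
      ≤ ∑ j ∈ s, ((1 - c * w) * (x j)⁻¹ ^ P + 3 * w * a⁻¹ ^ P) := by
        refine Finset.sum_le_sum fun j hj => ?_
        have hxj : 0 < x j := ha.trans_le (hx j hj)
        have hpow : (x j)⁻¹ ^ P ≤ a⁻¹ ^ P := by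
          gcongr
          exact hx j hj
        have h1 : 0 ≤ (x j)⁻¹ ^ P * (w * (h / x j)) := by positivity
        have h2 : (1 + 2 * c) * (w * (x j)⁻¹ ^ P) ≤ 3 * (w * a⁻¹ ^ P) := by
          gcongr
          linarith
        linarith
    _ = _ := by
        rw [Finset.sum_add_distrib, ← Finset.mul_sum, Finset.sum_const, nsmul_eq_mul]
        ring

lemma IsGapWindow.one_add_mul_le_softmaxGap {β b a c δ d : ℝ} {P : ℕ}
    (hw : IsGapWindow q β b a c) (hn : 0 < n) (hP : IsPotentialScale n q c δ P) (hδd : δ ≤ d)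
    (hda : d ≤ a) : (1 + 3 * c) * d ≤ softmaxGap q (β * (d - 1 / n)) := by
  have hc0 := hw.c_pos.le
  have hn8 : 8 / n ≤ c * d := (hP.eight_div_le hn hc0).trans (by gcongr)
  have hn0 : 0 ≤ (1 : ℝ) / n := by positivity
  have hn1 : (8 : ℝ) / n = 8 * (1 / n) := by ring
  have hd := hP.cutoff_pos.trans_le hδd
  have := mul_le_mul_of_nonneg_right hw.c_le_one hd.le
  have := mul_le_mul_of_nonneg_right hw.c_le_one hn0
  exact le_trans (by linarith) (hw.expansion (d - 1 / n) ⟨by linarith, by linarith⟩)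

lemma IsGapWindow.sum_gap_inv_pow_le {β b a c δ : ℝ} {P : ℕ} (hw : IsGapWindow q β b a c)
    (hβ : 0 ≤ β) (hn : 0 < n) (hP : IsPotentialScale n q c δ P) {i m : Fin q} (hm : m ≠ i)
    {σ : Config n q} (hσ : δ ≤ gap i m σ)
    (hmin : ∀ j ∈ Finset.univ.erase i, gap i m σ ≤ gap i j σ) :
    ∑ j ∈ Finset.univ.erase i, (gap i j σ)⁻¹ ^ P *
        (1 + c * (P / n) - P / n * (softmaxGap q (β * (gap i m σ - 1 / n)) / gap i j σ - 1)) ≤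
      (1 - c * (P / n)) * ∑ j ∈ Finset.univ.erase i, (gap i j σ)⁻¹ ^ P +
        3 * q * (P / n) * a⁻¹ ^ P := by
  have hc0 := hw.c_pos.le
  have hδ := hP.cutoff_pos
  have ha : 0 < a := hw.b_pos.trans hw.b_lt_a
  rcases le_total (gap i m σ) a with h | h
  · refine (sum_inv_pow_mul_le_of_expansion (Finset.mem_erase.2 ⟨hm, Finset.mem_univ m⟩)
      (hδ.trans_le hσ) hmin hc0 (by positivity) (hw.one_add_mul_le_softmaxGap hn hP hσ h)
      (le_trans (by gcongr; exact card_erase_le i) hP.card_mul_le)).trans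
        (le_add_of_nonneg_right (by positivity))
  · have hgap : 0 ≤ gap i m σ - 1 / n :=
      sub_nonneg.2 ((hP.one_div_le hn hc0 hw.c_le_one).trans hσ)
    refine (sum_inv_pow_mul_le_of_le ha (fun j hj => h.trans (hmin j hj)) hw.c_le_one
      (by positivity) (softmaxGap_nonneg (Nat.one_le_cast.2 i.pos) (mul_nonneg hβ hgap)) P).trans ?_
    gcongr
    exact card_erase_le i

lemma IsGapWindow.driftCondition_gapPot {β b a c δ : ℝ} {P : ℕ} (hw : IsGapWindow q β b a c)
    (hq : 1 < q) (hβ : 0 ≤ β) (hn : 0 < n) (hP : IsPotentialScale n q c δ P) (i : Fin q) :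
    DriftCondition (glauber n q β) (gapPot i δ P) (leadSet n i δ) (1 - c * (P / n))
      (3 * q * (P / n) * a⁻¹ ^ P) := by
  have hc0 := hw.c_pos.le
  have hδ := hP.cutoff_pos
  have ha : 0 < a := hw.b_pos.trans hw.b_lt_a
  refine ⟨gapPot_nonneg i hδ.le P, ?_, by linarith [show 0 ≤ c * (P / n : ℝ) by positivity],
    by positivity, fun σ hσ => ?_⟩
  · have hle : (P : ℝ) / n ≤ P / (n * δ) := by
      gcongr
      exact mul_le_of_le_one_right n.cast_nonneg hP.cutoff_le_one
    have := hP.exponent_div_le hn hc0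
    nlinarith [hw.c_le_one, show (0 : ℝ) ≤ P / n by positivity]
  obtain ⟨m, hm, hmin⟩ := Finset.exists_min_image (Finset.univ.erase i) (fun j => gap i j σ)
    (by rw [← Finset.card_pos, Finset.card_erase_of_mem (Finset.mem_univ i)]; simpa using hq)
  rw [Finset.mem_erase] at hm
  have hgap : 0 ≤ gap i m σ - 1 / n :=
    sub_nonneg.2 ((hP.one_div_le hn hc0 hw.c_le_one).trans (hσ m hm.1))
  have hlead : σ ∈ leadSet n i (gap i m σ - 1 / n + 1 / n) := fun j hj => by
    simpa using hmin j (Finset.mem_erase.2 ⟨hj, Finset.mem_univ j⟩)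
  have hpot : gapPot i δ P σ = ∑ j ∈ Finset.univ.erase i, (gap i j σ)⁻¹ ^ P :=
    Finset.sum_congr rfl fun j hj => by
      rw [max_eq_left ((half_le_self hδ.le).trans (hσ j (Finset.ne_of_mem_erase hj)))]
  have hsum : glauber n q β *ᵥ gapPot i δ P = ∑ j ∈ Finset.univ.erase i,
      glauber n q β *ᵥ fun τ => (max (gap i j τ) (δ / 2))⁻¹ ^ P := by
    rw [← Matrix.mulVec_sum]
    congr 1
    ext τ
    simp only [gapPot, Finset.sum_apply]
  rw [hsum, Finset.sum_apply, hpot]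
  refine le_trans (Finset.sum_le_sum fun j hj => ?_)
    (hw.sum_gap_inv_pow_le hβ hn hP hm.1 (hσ m hm.1) hmin)
  have hj := Finset.ne_of_mem_erase hj
  exact glauber_mulVec_max_gap_inv_pow_le hn hc0 hw.c_le_one hP (hσ j hj)
    (gap_add_le_glauber_mulVec_gap hn hβ hj hgap hlead)

end Potential

section Phases

variable {n q : ℕ}

lemma DriftCondition.mono {α : Type*} [Fintype α] {A : Matrix α α ℝ} {Ψ : α → ℝ} {G G' : Set α}
    {l e : ℝ} (h : DriftCondition A Ψ G l e) (hG : G' ⊆ G) : DriftCondition A Ψ G' l e :=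
  { h with mulVec_le := fun x hx => h.mulVec_le x (hG hx) }

lemma leadSet_antitone (n : ℕ) (i : Fin q) : Antitone (leadSet n i) :=
  fun _ _ hs _ hσ j hj => hs.trans (hσ j hj)

/-- An upper bound, derived from the potential `gapPot i δ P`, for the probability that `t` steps
of the Glauber dynamics do not raise the lead of spin `i` from `g` to `s`. -/
noncomputable def climbError (n q : ℕ) (c a δ : ℝ) (P : ℕ) (g s : ℝ) (t : ℕ) : ℝ :=
  q * ((s / g) ^ P * (1 - c * (P / n)) ^ t + (δ / g) ^ P) +
    t * (3 * q * (P / n)) * ((s / a) ^ P + (δ / a) ^ P)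

lemma IsGapWindow.glauber_pow_mulVec_le {β b a c δ : ℝ} {P : ℕ} (hw : IsGapWindow q β b a c)
    (hq : 1 < q) (hβ : 0 ≤ β) (hn : 0 < n) (hP : IsPotentialScale n q c δ P) {i : Fin q}
    {g s u : ℝ} (hg : 0 < g) (hs : 0 ≤ s) (hu : 0 ≤ u) {f : Config n q → ℝ}
    (hf : f ∈ Set.Icc 0 1) (hfΨ : ∀ σ, f σ ≤ s ^ P * gapPot i δ P σ + u) (t : ℕ)
    {σ : Config n q} (hσ : σ ∈ leadSet n i g) :
    (glauber n q β ^ t *ᵥ f) σ ≤ climbError n q c a δ P g s t + u := by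
  have hδ := hP.cutoff_pos
  have hΨ := hw.driftCondition_gapPot hq hβ hn hP i
  have hdrift := hΨ.pow_mulVec_le (glauber_mem_rowStochastic hn i.pos β) (pow_nonneg hδ.le P)
    (pow_nonneg hs P) hu
    (fun τ hτ => one_le_pow_mul_gapPot hδ (half_le_self hδ.le) P hτ) hf hfΨ t σ
  have hrate := hΨ.rate_nonneg
  have hcoef : 0 ≤ s ^ P * (1 - c * (P / n)) ^ t + δ ^ P := by positivity
  have hstart := mul_le_mul_of_nonneg_left (gapPot_le (δ := δ) hg P hσ) hcoef
  calc (glauber n q β ^ t *ᵥ f) σ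
      ≤ (s ^ P * (1 - c * (P / n)) ^ t + δ ^ P) * (q * g⁻¹ ^ P) +
          t * ((s ^ P + δ ^ P) * (3 * q * (P / n) * a⁻¹ ^ P)) + u := by linarith
    _ = climbError n q c a δ P g s t + u := by
      simp only [climbError, div_eq_mul_inv, mul_pow]
      ring

lemma IsGapWindow.glauber_pow_mulVec_le_of_le {β b a c δ : ℝ} {P : ℕ} (hw : IsGapWindow q β b a c)
    (hq : 1 < q) (hβ : 0 ≤ β) (hn : 0 < n) (hP : IsPotentialScale n q c δ P) {i : Fin q}
    {g s u : ℝ} (hg : 0 < g) (hs : δ / 2 ≤ s) (hu : 0 ≤ u) {f : Config n q → ℝ}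
    (hf : f ∈ Set.Icc 0 1) (hfs : ∀ σ ∈ leadSet n i s, f σ ≤ u) (t : ℕ)
    {σ : Config n q} (hσ : σ ∈ leadSet n i g) :
    (glauber n q β ^ t *ᵥ f) σ ≤ climbError n q c a δ P g s t + u := by
  have hδ := hP.cutoff_pos
  have hs0 : 0 ≤ s := (half_pos hδ).le.trans hs
  refine hw.glauber_pow_mulVec_le hq hβ hn hP hg hs0 hu hf (fun τ => ?_) t hσ
  by_cases hτ : τ ∈ leadSet n i s
  · exact (hfs τ hτ).trans
      (le_add_of_nonneg_left (mul_nonneg (pow_nonneg hs0 P) (gapPot_nonneg i hδ.le P τ)))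
  · exact (hf.2 τ).trans (le_add_of_le_of_nonneg (one_le_pow_mul_gapPot hδ hs P hτ) hu)

lemma le_climbError {c a δ g s : ℝ} {P : ℕ} (ha : 0 ≤ a) (hδ : 0 ≤ δ) (hg : 0 ≤ g) (hs : 0 ≤ s)
    (hrate : 0 ≤ 1 - c * (P / n)) (t : ℕ) :
    t * (s ^ P * (3 * q * (P / n) * a⁻¹ ^ P)) ≤ climbError n q c a δ P g s t := by
  have hpos : 0 ≤ q * ((s / g) ^ P * (1 - c * (P / n)) ^ t + (δ / g) ^ P) +
      t * (3 * q * (P / n)) * (δ / a) ^ P := by positivity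
  rw [climbError]
  calc t * (s ^ P * (3 * q * (P / n) * a⁻¹ ^ P)) = t * (3 * q * (P / n)) * (s / a) ^ P := by
        rw [div_eq_mul_inv s, mul_pow]
        ring
    _ ≤ _ := by linarith

lemma abs_sub_le_hammingDist {f : Config n q → ℝ} (hf : f ∈ Set.Icc 0 1) (σ σ' : Config n q) :
    |f σ - f σ'| ≤ hammingDist σ σ' := by
  rcases eq_or_ne σ σ' with rfl | h
  · simp
  · exact (abs_sub_le_of_nonneg_of_le (hf.1 σ) (hf.2 σ) (hf.1 σ') (hf.2 σ')).trans
      (Nat.one_le_cast.2 (hammingDist_pos.2 h))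

lemma contractionRate_nonneg (hn : 0 < n) {β : ℝ} (hβ : 0 ≤ β) (b : ℝ) :
    0 ≤ 1 - (1 - β * softmaxGapSlope q (Real.exp (-(β * b)))) / n := by
  have hslope : 0 ≤ β * softmaxGapSlope q (Real.exp (-(β * b))) := by
    unfold softmaxGapSlope
    positivity
  rw [sub_nonneg, div_le_one (Nat.cast_pos.2 hn)]
  linarith [Nat.one_le_cast (α := ℝ).2 hn]

lemma le_add_min_one_add_min_one {x w s s' : ℝ} (hw : 0 ≤ w) (hs : 0 ≤ s) (hs' : 0 ≤ s')
    (hx : x ≤ 1) (h : x ≤ w + s + s') : x ≤ w + min 1 s + min 1 s' := by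
  rcases min_cases 1 s with ⟨h1, -⟩ | ⟨h1, -⟩ <;> rcases min_cases 1 s' with ⟨h2, -⟩ | ⟨h2, -⟩ <;>
    rw [h1, h2] <;> linarith

lemma IsGapWindow.abs_glauber_pow_mulVec_sub_le {β b a c δ s : ℝ} {P : ℕ}
    (hw : IsGapWindow q β b a c) (hq : 1 < q) (hβ : 0 ≤ β) (hn : 0 < n)
    (hP : IsPotentialScale n q c δ P) (hδs : δ ≤ s) (hbs : b + 1 / n ≤ s) (i : Fin q)
    {f : Config n q → ℝ} (hf : f ∈ Set.Icc 0 1) (t : ℕ) (σ σ' : Config n q) :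
    |(glauber n q β ^ t *ᵥ f) σ - (glauber n q β ^ t *ᵥ f) σ'| ≤
      n * (1 - (1 - β * softmaxGapSlope q (Real.exp (-(β * b)))) / n) ^ t +
        min 1 (s ^ P * gapPot i δ P σ + t * (s ^ P * (3 * q * (P / n) * a⁻¹ ^ P))) +
        min 1 (s ^ P * gapPot i δ P σ' + t * (s ^ P * (3 * q * (P / n) * a⁻¹ ^ P))) := by
  have hδ := hP.cutoff_pos
  have hs : 0 ≤ s := hδ.le.trans hδs
  have hΨ := (hw.driftCondition_gapPot hq hβ hn hP i).mono (leadSet_antitone n i hδs)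
  have hA := glauber_mem_rowStochastic hn i.pos β
  have hmem := mulVec_mem_Icc_of_mem_rowStochastic (pow_mem hA t) hf
  have hrate := contractionRate_nonneg (q := q) hn hβ b
  have ha : 0 < a := hw.b_pos.trans hw.b_lt_a
  have hpot : ∀ τ : Config n q,
      0 ≤ s ^ P * gapPot i δ P τ + t * (s ^ P * (3 * q * (P / n) * a⁻¹ ^ P)) := fun τ => by
    have := gapPot_nonneg i hδ.le P τ
    positivity
  refine le_add_min_one_add_min_one (by positivity) (hpot σ) (hpot σ')
    (abs_sub_le_of_nonneg_of_le (hmem.1 σ) (hmem.2 σ) (hmem.1 σ') (hmem.2 σ')) ?_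
  refine (hΨ.abs_pow_mulVec_sub_le hA (pow_nonneg hs P)
    (fun τ hτ => one_le_pow_mul_gapPot hδ (by linarith) P hτ)
    (d := fun τ τ' => hammingDist τ τ') (fun _ _ => Nat.cast_nonneg _) hrate
    (fun τ hτ τ' hτ' => exists_isCoupling_glauber hn hβ hw.exp_le
      (leadSet_antitone n i hbs hτ) (leadSet_antitone n i hbs hτ'))
    hf (abs_sub_le_hammingDist hf) t σ σ').trans ?_
  rw [mul_comm (n : ℝ)]
  gcongr
  exact hammingDist_le_card_fintype.trans_eq (Fintype.card_fin n)

/-- The successive phases are: the smallest gap grows from `g` to `m`, then from `m` to `s`, and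
finally two copies of the dynamics coalesce. -/
lemma IsGapWindow.abs_glauber_pow_mulVec_sub_le_of_mem_leadSet {β b a c δ₁ δ₂ g m s : ℝ}
    {P₁ P₂ : ℕ} (hw : IsGapWindow q β b a c) (hq : 1 < q) (hβ : 0 ≤ β) (hn : 0 < n)
    (hP₁ : IsPotentialScale n q c δ₁ P₁) (hP₂ : IsPotentialScale n q c δ₂ P₂) (hg : 0 < g)
    (hm : δ₁ / 2 ≤ m) (hδs : δ₂ ≤ s) (hbs : b + 1 / n ≤ s) {i : Fin q} {f : Config n q → ℝ}
    (hf : f ∈ Set.Icc 0 1) (t : ℕ) {σ σ' : Config n q} (hσ : σ ∈ leadSet n i g)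
    (hσ' : σ' ∈ leadSet n i g) :
    |(glauber n q β ^ (3 * t) *ᵥ f) σ - (glauber n q β ^ (3 * t) *ᵥ f) σ'| ≤
      n * (1 - (1 - β * softmaxGapSlope q (Real.exp (-(β * b)))) / n) ^ t +
        2 * (climbError n q c a δ₁ P₁ g m t + 2 * climbError n q c a δ₂ P₂ m s t) := by
  set A := glauber n q β
  set w := n * (1 - (1 - β * softmaxGapSlope q (Real.exp (-(β * b)))) / n) ^ t
  set u : ℝ := t * (s ^ P₂ * (3 * q * (P₂ / n) * a⁻¹ ^ P₂))
  have hδ₂ := hP₂.cutoff_pos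
  have hs : 0 ≤ s := hδ₂.le.trans hδs
  have ha : 0 < a := hw.b_pos.trans hw.b_lt_a
  have hm0 : 0 < m := (half_pos hP₁.cutoff_pos).trans_le hm
  have hA : A ∈ Matrix.rowStochastic ℝ (Config n q) := glauber_mem_rowStochastic hn i.pos β
  have hu0 : 0 ≤ u := by positivity
  have hpot : ∀ τ : Config n q, 0 ≤ s ^ P₂ * gapPot i δ₂ P₂ τ := fun τ =>
    mul_nonneg (pow_nonneg hs P₂) (gapPot_nonneg i hδ₂.le P₂ τ)
  have hrate : 0 ≤ 1 - c * (P₂ / n : ℝ) := (hw.driftCondition_gapPot hq hβ hn hP₂ i).rate_nonneg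
  have hu : u ≤ climbError n q c a δ₂ P₂ m s t := le_climbError ha.le hδ₂.le hm0.le hs hrate t
  set B : Config n q → ℝ := fun τ => min 1 (s ^ P₂ * gapPot i δ₂ P₂ τ + u)
  have hB : B ∈ Set.Icc 0 1 :=
    ⟨fun τ => le_min zero_le_one (add_nonneg (hpot τ) hu0), fun τ => min_le_left _ _⟩
  have hcontract : ∀ τ τ', |(A ^ t *ᵥ f) τ - (A ^ t *ᵥ f) τ'| ≤ w + B τ + B τ' :=
    hw.abs_glauber_pow_mulVec_sub_le hq hβ hn hP₂ hδs hbs i hf t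
  have hsecond : ∀ τ ∈ leadSet n i m,
      (A ^ t *ᵥ B) τ ≤ climbError n q c a δ₂ P₂ m s t + u := fun τ hτ =>
    hw.glauber_pow_mulVec_le hq hβ hn hP₂ hm0 hs hu0 hB (fun _ => min_le_right _ _) t hτ
  have hfirst : ∀ τ ∈ leadSet n i g, (A ^ (t + t) *ᵥ B) τ ≤
      climbError n q c a δ₁ P₁ g m t + (climbError n q c a δ₂ P₂ m s t + u) := fun τ hτ => by
    rw [pow_add, ← Matrix.mulVec_mulVec]
    exact hw.glauber_pow_mulVec_le_of_le hq hβ hn hP₁ hg hm (by linarith)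
      (mulVec_mem_Icc_of_mem_rowStochastic (pow_mem hA t) hB) hsecond t hτ
  rw [show 3 * t = t + t + t by ring, pow_add, ← Matrix.mulVec_mulVec]
  have := abs_mulVec_sub_le_of_mem_rowStochastic (pow_mem hA (t + t)) hcontract σ σ'
  linarith [hfirst σ hσ, hfirst σ' hσ']

end Phases

section InitialLaws

variable {n q : ℕ}

/-- The probability vectors concentrated on the configurations in which spin `i` leads every other
spin by at least `g`. -/
def leadLaws (n : ℕ) (i : Fin q) (g : ℝ) : Set (Config n q → ℝ) :=
  {ν ∈ stdSimplex ℝ (Config n q) | ∀ σ, ν σ ≠ 0 → σ ∈ leadSet n i g}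

lemma proportionsProb_lawAt (β : ℝ) (ν : Config n q → ℝ) (t : ℕ) (S : Set (Fin q → ℝ)) :
    proportionsProb (lawAt β ν t) S =
      ν ⬝ᵥ (glauber n q β ^ t *ᵥ fun σ => S.indicator 1 (proportions σ)) := by
  classical
  rw [Matrix.dotProduct_mulVec]
  simp [proportionsProb, lawAt, dotProduct, Set.indicator_apply]

lemma proportionsTV_lawAt_le {β ε g : ℝ} {i : Fin q} {ν ν' : Config n q → ℝ}
    (hν : ν ∈ leadLaws n i g) (hν' : ν' ∈ leadLaws n i g) {t : ℕ}
    (h : ∀ f ∈ Set.Icc (0 : Config n q → ℝ) 1, ∀ σ ∈ leadSet n i g, ∀ σ' ∈ leadSet n i g,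
      |(glauber n q β ^ t *ᵥ f) σ - (glauber n q β ^ t *ᵥ f) σ'| ≤ ε) :
    proportionsTV (lawAt β ν t) (lawAt β ν' t) ≤ ε := by
  refine ciSup_le fun S => ?_
  rw [proportionsProb_lawAt, proportionsProb_lawAt]
  have hf : (fun σ : Config n q => S.indicator 1 (proportions σ)) ∈
      Set.Icc (0 : Config n q → ℝ) 1 :=
    ⟨fun σ => Set.indicator_nonneg (fun _ _ => zero_le_one) _,
      fun σ => Set.indicator_le_self' (fun _ _ => zero_le_one) _⟩
  have hdot := (isCoupling_mul hν.1 hν'.1).abs_dotProduct_sub_le (d := fun _ _ => ε) (B := 0)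
    fun σ σ' hp => by
      simpa using h _ hf σ (hν.2 σ (left_ne_zero_of_mul hp)) σ' (hν'.2 σ' (right_ne_zero_of_mul hp))
  simpa [← Finset.sum_mul, ← Finset.mul_sum, hν.1.2, hν'.1.2] using hdot

lemma pointMass_mem_leadLaws {i : Fin q} {g : ℝ} {σ : Config n q} (hσ : σ ∈ leadSet n i g) :
    pointMass σ ∈ leadLaws n i g := by
  refine ⟨single_mem_stdSimplex ℝ σ, fun τ hτ => ?_⟩
  obtain rfl : τ = σ := by
    by_contra hne
    exact hτ (Pi.single_eq_of_ne hne 1)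
  exact hσ

lemma gibbs_pos (β : ℝ) (σ : Config n q) : 0 < gibbs n q β σ :=
  div_pos (Real.exp_pos _) (Finset.sum_pos (fun _ _ => Real.exp_pos _) ⟨σ, Finset.mem_univ σ⟩)

lemma gibbsOrdered_mem_stdSimplex {β : ℝ} {i : Fin q} {r : ℝ}
    (h : (orderedPhase n q β i r).Nonempty) :
    gibbsOrdered n q β i r ∈ stdSimplex ℝ (Config n q) := by
  classical
  have hnonneg : ∀ σ, 0 ≤ if σ ∈ orderedPhase n q β i r then gibbs n q β σ else 0 := fun σ => by
    split_ifs
    exacts [(gibbs_pos β σ).le, le_rfl]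
  obtain ⟨σ, hσ⟩ := h
  have hpos : 0 < ∑ τ, if τ ∈ orderedPhase n q β i r then gibbs n q β τ else 0 :=
    Finset.sum_pos' (fun τ _ => hnonneg τ)
      ⟨σ, Finset.mem_univ σ, (gibbs_pos β σ).trans_eq (if_pos hσ).symm⟩
  refine ⟨fun τ => ?_, ?_⟩
  · simp only [gibbsOrdered]
    convert div_nonneg (hnonneg τ) hpos.le
  · simp only [gibbsOrdered]
    convert div_self hpos.ne'
    rw [← Finset.sum_div]

lemma mem_orderedPhase_of_gibbsOrdered_ne_zero {β : ℝ} {i : Fin q} {r : ℝ} {σ : Config n q}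
    (h : gibbsOrdered n q β i r σ ≠ 0) : σ ∈ orderedPhase n q β i r := by
  by_contra hσ
  exact h (by simp [gibbsOrdered, hσ])

lemma orderedPhase_subset_leadSet (n : ℕ) (β : ℝ) (i : Fin q) (r : ℝ) :
    orderedPhase n q β i r ⊆ leadSet n i (mr q β - (1 - mr q β) / (q - 1) - 2 * r) := by
  intro σ hσ j hj
  have hcoord : ∀ k, |proportions σ k - orderedPoint q β i k| ≤ r := fun k =>
    (Finset.single_le_sum (f := fun k => |proportions σ k - orderedPoint q β i k|)
      (fun _ _ => abs_nonneg _) (Finset.mem_univ k)).trans hσ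
  have hi := (abs_le.1 (hcoord i)).1
  have hj' := (abs_le.1 (hcoord j)).2
  simp only [orderedPoint, if_true, if_neg hj] at hi hj'
  rw [gap]
  linarith

lemma eventually_orderedPhase_subset_leadSet (hq : 1 < q) {β : ℝ} (hmr : 1 / (q : ℝ) < mr q β)
    (i : Fin q) {r g : ℕ → ℝ} (hr : Tendsto r atTop (𝓝 0)) (hg : Tendsto g atTop (𝓝 0)) :
    ∀ᶠ n in atTop, orderedPhase n q β i (r n) ⊆ leadSet n i (g n) := by
  have hq1 : (0 : ℝ) < q - 1 := sub_pos.2 (Nat.one_lt_cast.2 hq)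
  have hlead : 0 < mr q β - (1 - mr q β) / (q - 1) := by
    rw [div_lt_iff₀ (by linarith)] at hmr
    rw [sub_pos, div_lt_iff₀ hq1]
    linarith
  have hlim : Tendsto (fun n => g n + 2 * r n) atTop (𝓝 0) := by
    simpa using hg.add (hr.const_mul 2)
  filter_upwards [hlim.eventually (Iio_mem_nhds hlead)] with n hn
  exact (orderedPhase_subset_leadSet n β i (r n)).trans
    (leadSet_antitone n i (by linarith))

lemma eventually_gibbsOrdered_mem_leadLaws (hq : 1 < q) {β : ℝ} (hmr : 1 / (q : ℝ) < mr q β)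
    (i : Fin q) {r g : ℕ → ℝ} (hr : Tendsto r atTop (𝓝 0)) (hg : Tendsto g atTop (𝓝 0))
    (hne : ∀ᶠ n in atTop, (orderedPhase n q β i (r n)).Nonempty) :
    ∀ᶠ n in atTop, gibbsOrdered n q β i (r n) ∈ leadLaws n i (g n) := by
  filter_upwards [eventually_orderedPhase_subset_leadSet hq hmr i hr hg, hne] with n hsub hne
  exact ⟨gibbsOrdered_mem_stdSimplex hne,
    fun σ hσ => hsub (mem_orderedPhase_of_gibbsOrdered_ne_zero hσ)⟩

end InitialLaws

section Asymptotics

/-- The duration of one phase of the dynamics. -/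
noncomputable def phaseTime (C : ℝ) (n : ℕ) : ℕ := ⌈C * (n * Real.log n)⌉₊

/-- The lead at which the dynamics passes from the first climb, with a potential of fixed exponent,
to the second one. -/
noncomputable def midLead (n : ℕ) : ℝ := (n : ℝ) ^ (-(1 / 4) : ℝ)

/-- The exponent of the potential used above `midLead n`, where the fluctuations of the lead, of
order `n ^ (-1 / 2)`, allow an exponent of order `n * midLead n ^ 2 = n ^ (1 / 2)`. -/
noncomputable def midExponent (c : ℝ) (n : ℕ) : ℕ := ⌊c * (n : ℝ) ^ (1 / 2 : ℝ) / 32⌋₊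

lemma phaseTime_le {C : ℝ} (hC : 0 ≤ C) (n : ℕ) :
    (phaseTime C n : ℝ) ≤ C * (n * Real.log n) + 1 := by
  have := Real.log_natCast_nonneg n
  exact (Nat.ceil_lt_add_one (by positivity)).le

lemma isBigO_phaseTime {C : ℝ} (hC : 0 ≤ C) :
    (fun n => (phaseTime C n : ℝ)) =O[atTop] fun n : ℕ => (n : ℝ) * Real.log n := by
  refine IsBigO.of_bound (C + 1) ?_
  filter_upwards [eventually_ge_atTop 3] with n hn
  have hn3 : (3 : ℝ) ≤ n := by exact_mod_cast hn
  have hlog : 1 ≤ Real.log n := by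
    rw [Real.le_log_iff_exp_le (by linarith)]
    linarith [Real.exp_one_lt_d9]
  have hone : 1 ≤ (n : ℝ) * Real.log n := by nlinarith
  rw [Real.norm_of_nonneg (Nat.cast_nonneg _), Real.norm_of_nonneg (by linarith)]
  linarith [phaseTime_le hC n]

lemma tendsto_rpow_neg_natCast {s : ℝ} (hs : 0 < s) :
    Tendsto (fun n : ℕ => (n : ℝ) ^ (-s)) atTop (𝓝 0) :=
  (tendsto_rpow_neg_atTop hs).comp tendsto_natCast_atTop_atTop

lemma midLead_pos {n : ℕ} (hn : 0 < n) : 0 < midLead n :=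
  Real.rpow_pos_of_pos (Nat.cast_pos.2 hn) _

lemma tendsto_midLead : Tendsto midLead atTop (𝓝 0) :=
  tendsto_rpow_neg_natCast (by norm_num)

lemma tendsto_midLead_mul_atTop : Tendsto (fun n => midLead n * n) atTop atTop := by
  refine ((tendsto_rpow_atTop (y := 3 / 4) (by norm_num)).comp
    tendsto_natCast_atTop_atTop).congr' ?_
  filter_upwards [eventually_gt_atTop 0] with n hn
  rw [midLead, ← Real.rpow_add_one (Nat.cast_ne_zero.2 hn.ne'), Function.comp_apply]
  norm_num

lemma tendsto_phaseTime_div_mul_rpow_neg {C s : ℝ} (hC : 0 ≤ C) (hs : 0 < s) :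
    Tendsto (fun n : ℕ => phaseTime C n / n * (n : ℝ) ^ (-s)) atTop (𝓝 0) := by
  have hlog : (fun n : ℕ => Real.log n) =o[atTop] fun n : ℕ => (n : ℝ) ^ s :=
    (isLittleO_log_rpow_atTop hs).comp_tendsto tendsto_natCast_atTop_atTop
  have hlittle := ((isBigO_phaseTime hC).trans_isLittleO
    ((isBigO_refl (fun n : ℕ => (n : ℝ)) atTop).mul_isLittleO hlog)).tendsto_div_nhds_zero
  refine hlittle.congr fun n => ?_
  rw [Real.rpow_neg n.cast_nonneg, ← div_eq_mul_inv, div_div]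

lemma one_sub_div_pow_phaseTime_le {C x : ℝ} {n m : ℕ} (hn : 0 < n) (hx0 : 0 ≤ x)
    (hx : x / n ≤ 1) (hm : m ≤ x * C) : (1 - x / n) ^ phaseTime C n ≤ (n : ℝ)⁻¹ ^ m := by
  have hn' : (0 : ℝ) < n := Nat.cast_pos.2 hn
  have htime : C * (n * Real.log n) ≤ phaseTime C n := Nat.le_ceil _
  have hexponent : m * Real.log n ≤ phaseTime C n * (x / n) :=
    calc m * Real.log n ≤ x * C * Real.log n :=
          mul_le_mul_of_nonneg_right hm (Real.log_natCast_nonneg n)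
      _ = C * (n * Real.log n) * (x / n) := by field_simp
      _ ≤ phaseTime C n * (x / n) := by gcongr
  calc (1 - x / n) ^ phaseTime C n ≤ Real.exp (-(x / n)) ^ phaseTime C n :=
        pow_le_pow_left₀ (sub_nonneg.2 hx) (Real.one_sub_le_exp_neg _) _
    _ = Real.exp (phaseTime C n * -(x / n)) := (Real.exp_nat_mul _ _).symm
    _ ≤ Real.exp (m * -Real.log n) := Real.exp_le_exp.2 (by linarith)
    _ = (n : ℝ)⁻¹ ^ m := by rw [Real.exp_nat_mul, Real.exp_neg, Real.exp_log hn']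

lemma tendsto_natCast_mul_one_sub_div_pow_phaseTime {C x : ℝ} (hx0 : 0 ≤ x) (hx : 2 ≤ x * C) :
    Tendsto (fun n : ℕ => n * (1 - x / n) ^ phaseTime C n) atTop (𝓝 0) := by
  have hrate := (tendsto_const_div_atTop_nhds_zero_nat x).eventually_le_const zero_lt_one
  refine squeeze_zero' ?_ ?_ tendsto_inv_atTop_nhds_zero_nat
  · filter_upwards [hrate] with n hn
    exact mul_nonneg n.cast_nonneg (pow_nonneg (sub_nonneg.2 hn) _)
  · filter_upwards [hrate, eventually_gt_atTop 0] with n hxn hn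
    calc n * (1 - x / n) ^ phaseTime C n ≤ n * (n : ℝ)⁻¹ ^ 2 := by
          gcongr
          exact one_sub_div_pow_phaseTime_le hn hx0 hxn (by exact_mod_cast hx)
      _ = (n : ℝ)⁻¹ := by
          have : (n : ℝ) ≠ 0 := Nat.cast_ne_zero.2 hn.ne'
          field_simp

lemma tendsto_mul_pow_of_tendsto_mul {u v : ℕ → ℝ} (huv : Tendsto (fun n => u n * v n) atTop (𝓝 0))
    (hv : Tendsto v atTop (𝓝 0)) {p : ℕ} (hp : p ≠ 0) :
    Tendsto (fun n => u n * v n ^ p) atTop (𝓝 0) := by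
  obtain ⟨k, rfl⟩ := Nat.exists_eq_succ_of_ne_zero hp
  have hprod := huv.mul (hv.pow k)
  rw [zero_mul] at hprod
  exact hprod.congr fun n => by rw [mul_assoc, pow_succ']

/-- The contraction over a phase, `n ^ (-P)`, beats the factor `(s / g) ^ P` lost by the bounds on
the potential, whatever the exponent `P`. -/
lemma div_pow_mul_one_sub_pow_phaseTime_le {C c g s : ℝ} {n P : ℕ} (hn : 0 < n) (hc : 0 ≤ c)
    (hC : 1 ≤ c * C) (hP : c * (P / n) ≤ 1) (hg : 0 ≤ g) (hs : 0 ≤ s) :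
    (s / g) ^ P * (1 - c * (P / n)) ^ phaseTime C n ≤ (s / (g * n)) ^ P := by
  have hpow : (1 - c * (P / n)) ^ phaseTime C n ≤ (n : ℝ)⁻¹ ^ P := by
    rw [← mul_div_assoc] at hP ⊢
    refine one_sub_div_pow_phaseTime_le hn (by positivity) hP ?_
    nlinarith [P.cast_nonneg (α := ℝ)]
  calc (s / g) ^ P * (1 - c * (P / n)) ^ phaseTime C n ≤ (s / g) ^ P * (n : ℝ)⁻¹ ^ P := by gcongr
    _ = (s / (g * n)) ^ P := by rw [← mul_pow, ← div_eq_mul_inv, div_div]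

lemma midLead_eq_mul {n : ℕ} (hn : 0 < n) :
    midLead n = (n : ℝ) ^ (-(3 / 4) : ℝ) * ((n : ℝ) ^ (-(1 / 2) : ℝ) * n) := by
  have hn' : (0 : ℝ) < n := Nat.cast_pos.2 hn
  rw [midLead, ← Real.rpow_add_one hn'.ne', ← Real.rpow_add hn']
  norm_num

lemma tendsto_climbError_fixed {q : ℕ} {C c a r γ : ℝ} (hC₀ : 0 ≤ C) (hc : 0 ≤ c)
    (hC : 1 ≤ c * C) (hγ : 0 < γ) {p : ℕ} (hp : p ≠ 0) :
    Tendsto (fun n : ℕ => climbError n q c a (r * (n : ℝ) ^ (-(1 / 2) : ℝ)) p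
      (γ * (n : ℝ) ^ (-(1 / 2) : ℝ)) (midLead n) (phaseTime C n)) atTop (𝓝 (q * (r / γ) ^ p)) := by
  have hcut : Tendsto (fun n : ℕ => r * (n : ℝ) ^ (-(1 / 2) : ℝ)) atTop (𝓝 0) := by
    simpa using (tendsto_rpow_neg_natCast (s := 1 / 2) (by norm_num)).const_mul r
  have hrate : ∀ᶠ n : ℕ in atTop, c * (p / n) ≤ 1 := by
    simpa only [mul_div_assoc] using
      (tendsto_const_div_atTop_nhds_zero_nat (c * p)).eventually_le_const zero_lt_one
  have hdecay : Tendsto (fun n : ℕ => (midLead n / (γ * (n : ℝ) ^ (-(1 / 2) : ℝ))) ^ p *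
      (1 - c * (p / n)) ^ phaseTime C n) atTop (𝓝 0) := by
    have hlim : Tendsto (fun n : ℕ => ((n : ℝ) ^ (-(3 / 4) : ℝ) / γ) ^ p) atTop (𝓝 0) := by
      simpa [hp] using ((tendsto_rpow_neg_natCast (s := 3 / 4) (by norm_num)).div_const γ).pow p
    refine squeeze_zero' ?_ ?_ hlim
    · filter_upwards [hrate] with n hn
      have := sub_nonneg.2 hn
      unfold midLead
      positivity
    · filter_upwards [hrate, eventually_gt_atTop 0] with n hrate hn
      have hpos : 0 < (n : ℝ) ^ (-(1 / 2) : ℝ) * n := by positivity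
      refine (div_pow_mul_one_sub_pow_phaseTime_le hn hc hC hrate (by positivity)
        (by unfold midLead; positivity)).trans_eq ?_
      rw [midLead_eq_mul hn, mul_assoc γ, mul_div_mul_right _ _ hpos.ne']
  have hexitMid := tendsto_mul_pow_of_tendsto_mul (v := midLead)
    (tendsto_phaseTime_div_mul_rpow_neg hC₀ (s := 1 / 4) (by norm_num)) tendsto_midLead hp
  have hexitCut := tendsto_mul_pow_of_tendsto_mul (u := fun n => phaseTime C n / n) (by
    simpa [mul_left_comm] using (tendsto_phaseTime_div_mul_rpow_neg hC₀
      (s := 1 / 2) (by norm_num)).const_mul r) hcut hp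
  have hsum := ((hdecay.add_const ((r / γ) ^ p)).const_mul (q : ℝ)).add
    ((hexitMid.add hexitCut).const_mul (3 * q * p / a ^ p))
  simp only [zero_add, add_zero, mul_zero] at hsum
  refine hsum.congr' ?_
  filter_upwards [eventually_gt_atTop 0] with n hn
  have hpos : 0 < (n : ℝ) ^ (-(1 / 2) : ℝ) := Real.rpow_pos_of_pos (Nat.cast_pos.2 hn) _
  rw [climbError, mul_div_mul_right _ _ hpos.ne', div_pow (midLead n) a, div_pow _ a]
  ring

lemma midExponent_le {c : ℝ} (hc : 0 ≤ c) (n : ℕ) :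
    8 * (midExponent c n : ℝ) ≤ c * (n * (midLead n / 2) ^ 2) := by
  rcases n.eq_zero_or_pos with rfl | hn
  · simp [midExponent]
  have hn' : (0 : ℝ) < n := Nat.cast_pos.2 hn
  have hsq : n * midLead n ^ 2 = (n : ℝ) ^ (1 / 2 : ℝ) := by
    rw [midLead, ← Real.rpow_mul_natCast hn'.le, mul_comm, ← Real.rpow_add_one hn'.ne']
    norm_num
  have hfloor : (midExponent c n : ℝ) ≤ c * (n : ℝ) ^ (1 / 2 : ℝ) / 32 :=
    Nat.floor_le (by positivity)
  rw [← hsq] at hfloor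
  linarith

lemma tendsto_midExponent {c : ℝ} (hc : 0 < c) : Tendsto (midExponent c) atTop atTop :=
  tendsto_nat_floor_atTop.comp ((((tendsto_rpow_atTop (by norm_num)).comp
    tendsto_natCast_atTop_atTop).const_mul_atTop hc).atTop_div_const (by norm_num))

lemma tendsto_phaseTime_mul_midExponent_mul_pow {C c x : ℝ} (hC : 0 ≤ C) (hc : 0 < c)
    (hx₀ : 0 ≤ x) (hx : x < 1) :
    Tendsto (fun n => phaseTime C n * (midExponent c n / n) * x ^ midExponent c n)
      atTop (𝓝 0) := by
  have habs : |x| < 1 := by rwa [abs_of_nonneg hx₀]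
  have hpoly : Tendsto (fun n => ((midExponent c n : ℝ) ^ 2 + midExponent c n) *
      x ^ midExponent c n) atTop (𝓝 0) := by
    simpa [add_mul, Function.comp_def] using
      ((tendsto_pow_const_mul_const_pow_of_abs_lt_one 2 habs).add
        (tendsto_pow_const_mul_const_pow_of_abs_lt_one 1 habs)).comp (tendsto_midExponent hc)
  have hbound := ((tendsto_phaseTime_div_mul_rpow_neg hC (s := 1 / 2) (by norm_num)).mul
    hpoly).const_mul (32 / c)
  simp only [mul_zero] at hbound
  refine squeeze_zero' (Eventually.of_forall fun n => by positivity) ?_ hbound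
  filter_upwards [eventually_gt_atTop 0] with n hn
  have hfloor : c * (n : ℝ) ^ (1 / 2 : ℝ) / 32 ≤ midExponent c n + 1 :=
    (Nat.lt_floor_add_one _).le
  have hone : 1 ≤ 32 / c * (n : ℝ) ^ (-(1 / 2) : ℝ) * (midExponent c n + 1) := by
    rw [Real.rpow_neg n.cast_nonneg]
    have hpos : 0 < (n : ℝ) ^ (1 / 2 : ℝ) := by positivity
    generalize (n : ℝ) ^ (1 / 2 : ℝ) = y at *
    field_simp
    linarith
  calc (phaseTime C n : ℝ) * (midExponent c n / n) * x ^ midExponent c n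
      ≤ phaseTime C n * (midExponent c n / n) * x ^ midExponent c n *
          (32 / c * (n : ℝ) ^ (-(1 / 2) : ℝ) * (midExponent c n + 1)) :=
        le_mul_of_one_le_right (by positivity) hone
    _ = _ := by ring

lemma eventually_mul_midExponent_div_le_one {c : ℝ} (hc : 0 ≤ c) :
    ∀ᶠ n : ℕ in atTop, c * (midExponent c n / n) ≤ 1 := by
  have hlim : Tendsto (fun n => c * (c / 32 * midLead n ^ 2)) atTop (𝓝 0) := by
    simpa using ((tendsto_midLead.pow 2).const_mul (c / 32)).const_mul c
  filter_upwards [hlim.eventually_le_const zero_lt_one, eventually_gt_atTop 0] with n hle hn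
  refine (mul_le_mul_of_nonneg_left ?_ hc).trans hle
  rw [div_le_iff₀ (Nat.cast_pos.2 hn)]
  linarith [midExponent_le hc n]

lemma tendsto_climbError_midLead {q : ℕ} {C c a s : ℝ} (hC₀ : 0 ≤ C) (hc : 0 < c)
    (hC : 1 ≤ c * C) (hs : 0 < s) (hsa : s < a) :
    Tendsto (fun n : ℕ => climbError n q c a (midLead n / 2) (midExponent c n) (midLead n) s
      (phaseTime C n)) atTop (𝓝 0) := by
  have ha : 0 < a := hs.trans hsa
  have hratio : Tendsto (fun n : ℕ => s / (midLead n * n)) atTop (𝓝 0) :=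
    tendsto_const_nhds.div_atTop tendsto_midLead_mul_atTop
  have hbound : Tendsto (fun n => q * (2 * (1 / 2 : ℝ) ^ midExponent c n) +
      6 * q * (phaseTime C n * (midExponent c n / n) * (s / a) ^ midExponent c n))
      atTop (𝓝 0) := by
    simpa using ((((tendsto_pow_atTop_nhds_zero_of_lt_one (r := (1 / 2 : ℝ)) (by norm_num)
      (by norm_num)).comp (tendsto_midExponent hc)).const_mul 2).const_mul (q : ℝ)).add
      ((tendsto_phaseTime_mul_midExponent_mul_pow hC₀ hc (div_pos hs ha).le
        ((div_lt_one ha).2 hsa)).const_mul (6 * q : ℝ))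
  refine squeeze_zero' ?_ ?_ hbound
  · filter_upwards [eventually_mul_midExponent_div_le_one hc.le] with n hrate
    have := sub_nonneg.2 hrate
    unfold climbError midLead
    positivity
  · filter_upwards [eventually_mul_midExponent_div_le_one hc.le, eventually_gt_atTop 0,
      hratio.eventually_le_const one_half_pos, tendsto_midLead.eventually_le_const hs]
      with n hrate hn hhalf hle
    have hpos := midLead_pos hn
    have hdecay := (div_pow_mul_one_sub_pow_phaseTime_le hn hc.le hC hrate hpos.le hs.le).trans
      (pow_le_pow_left₀ (by positivity) hhalf _)
    have hexit : (midLead n / 2 / a) ^ midExponent c n ≤ (s / a) ^ midExponent c n := by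
      gcongr
      linarith
    calc climbError n q c a (midLead n / 2) (midExponent c n) (midLead n) s (phaseTime C n)
        ≤ q * ((1 / 2) ^ midExponent c n + (1 / 2) ^ midExponent c n) +
            phaseTime C n * (3 * q * (midExponent c n / n)) *
              ((s / a) ^ midExponent c n + (s / a) ^ midExponent c n) := by
          rw [climbError, div_right_comm, div_self hpos.ne']
          gcongr
      _ = _ := by ring

lemma exists_forall_ge_mul_pow_le (q : ℕ) {c : ℝ} (hc : 0 < c) :
    ∃ p : ℕ, 1 ≤ p ∧ ∀ P ≥ p, q * ((1 + 2 * c) * ((1 + 2 * c) / (1 + 3 * c)) ^ P) ≤ c := by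
  have hlt : (1 + 2 * c) / (1 + 3 * c) < 1 := by
    rw [div_lt_one (by positivity)]
    linarith
  have hlim : Tendsto (fun P : ℕ => q * ((1 + 2 * c) * ((1 + 2 * c) / (1 + 3 * c)) ^ P))
      atTop (𝓝 0) := by
    simpa using ((tendsto_pow_atTop_nhds_zero_of_lt_one (by positivity) hlt).const_mul
      (1 + 2 * c)).const_mul (q : ℝ)
  obtain ⟨p, hp⟩ := eventually_atTop.1 (hlim.eventually_le_const hc)
  exact ⟨max 1 p, le_max_left _ _, fun P hP => hp P ((le_max_right _ _).trans hP)⟩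

lemma eventually_isPotentialScale_fixed {q p : ℕ} {c : ℝ} (hc : 0 < c) (hp : 1 ≤ p)
    (hcard : q * ((1 + 2 * c) * ((1 + 2 * c) / (1 + 3 * c)) ^ p) ≤ c) :
    ∀ᶠ n : ℕ in atTop,
      IsPotentialScale n q c (√(8 * p / c) * (n : ℝ) ^ (-(1 / 2) : ℝ)) p := by
  have hcut : Tendsto (fun n : ℕ => √(8 * p / c) * (n : ℝ) ^ (-(1 / 2) : ℝ)) atTop (𝓝 0) := by
    simpa using (tendsto_rpow_neg_natCast (s := 1 / 2) (by norm_num)).const_mul √(8 * p / c)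
  filter_upwards [hcut.eventually_le_const zero_lt_one, eventually_gt_atTop 0] with n hle hn
  have hn' : (0 : ℝ) < n := Nat.cast_pos.2 hn
  have : (0 : ℝ) < p := Nat.cast_pos.2 hp
  refine ⟨hp, by positivity, hle, hcard, le_of_eq ?_⟩
  rw [mul_pow, Real.sq_sqrt (by positivity), ← Real.rpow_mul_natCast hn'.le]
  norm_num [Real.rpow_neg_one]
  field_simp

lemma eventually_isPotentialScale_midLead {q p : ℕ} {c : ℝ} (hc : 0 < c) (hp : 1 ≤ p)
    (hcard : ∀ P ≥ p, q * ((1 + 2 * c) * ((1 + 2 * c) / (1 + 3 * c)) ^ P) ≤ c) :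
    ∀ᶠ n : ℕ in atTop, IsPotentialScale n q c (midLead n / 2) (midExponent c n) := by
  filter_upwards [tendsto_midLead.eventually_le_const zero_lt_one, eventually_gt_atTop 0,
    (tendsto_midExponent hc).eventually_ge_atTop p] with n hle hn hP
  have hpos := midLead_pos hn
  exact ⟨hp.trans hP, half_pos hpos, by linarith, hcard _ hP, midExponent_le hc.le n⟩

end Asymptotics

section MixingTime

lemma eventually_mul_rpow_le_midLead (r : ℝ) :
    ∀ᶠ n : ℕ in atTop, r * (n : ℝ) ^ (-(1 / 2) : ℝ) ≤ midLead n := by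
  have hlim : Tendsto (fun n => r * midLead n) atTop (𝓝 0) := by
    simpa using tendsto_midLead.const_mul r
  filter_upwards [hlim.eventually_le_const zero_lt_one, eventually_gt_atTop 0] with n hle hn
  have hsq : (n : ℝ) ^ (-(1 / 2) : ℝ) = midLead n * midLead n := by
    rw [midLead, ← Real.rpow_add (Nat.cast_pos.2 hn)]
    norm_num
  rw [hsq, ← mul_assoc]
  exact mul_le_of_le_one_left (midLead_pos hn).le hle

lemma IsGapWindow.eventually_abs_glauber_pow_mulVec_sub_le {q p : ℕ} {β b a c C γ : ℝ}
    (hw : IsGapWindow q β b a c) (hq : 1 < q) (hβ : 0 ≤ β) (hCc : 1 ≤ c * C)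
    (hCκ : 2 ≤ (1 - β * softmaxGapSlope q (Real.exp (-(β * b)))) * C) (hp : 1 ≤ p)
    (hcard : ∀ P ≥ p, q * ((1 + 2 * c) * ((1 + 2 * c) / (1 + 3 * c)) ^ P) ≤ c) (hγ : 0 < γ) :
    ∀ᶠ n : ℕ in atTop, ∀ i : Fin q, ∀ f ∈ Set.Icc (0 : Config n q → ℝ) 1,
      ∀ σ ∈ leadSet n i (γ * (n : ℝ) ^ (-(1 / 2) : ℝ)),
      ∀ σ' ∈ leadSet n i (γ * (n : ℝ) ^ (-(1 / 2) : ℝ)),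
        |(glauber n q β ^ (3 * phaseTime C n) *ᵥ f) σ -
          (glauber n q β ^ (3 * phaseTime C n) *ᵥ f) σ'| ≤
            (2 * q + 1) * (√(8 * p / c) / γ) ^ p := by
  have hc := hw.c_pos
  have hp₀ : p ≠ 0 := Nat.one_le_iff_ne_zero.1 hp
  have hC : 0 ≤ C := (pos_of_mul_pos_right (zero_lt_one.trans_le hCc) hc.le).le
  obtain ⟨s, hbs, hsa⟩ := exists_between hw.b_lt_a
  have hs : 0 < s := hw.b_pos.trans hbs
  set r := √(8 * p / c)
  have hr : 0 < (r / γ) ^ p := by positivity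
  have hlim := (tendsto_natCast_mul_one_sub_div_pow_phaseTime
    (sub_nonneg.2 hw.contraction.le) hCκ).add (((tendsto_climbError_fixed (a := a) (r := r) (q := q)
      hC hc.le hCc hγ hp₀).add ((tendsto_climbError_midLead (q := q) hC hc hCc hs
        hsa).const_mul 2)).const_mul 2)
  have hlt : 0 + 2 * (q * (r / γ) ^ p + 2 * 0) < (2 * q + 1) * (r / γ) ^ p := by linarith
  filter_upwards [hlim.eventually_le_const hlt,
    eventually_gt_atTop 0, eventually_mul_rpow_le_midLead r, tendsto_midLead.eventually_le_const hs,
    eventually_isPotentialScale_fixed hc hp (hcard p le_rfl),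
    eventually_isPotentialScale_midLead hc hp hcard,
    tendsto_one_div_atTop_nhds_zero_nat.eventually_le_const (sub_pos.2 hbs)]
    with n hle hn hcut hmid hP₁ hP₂ hn_inv i f hf σ hσ σ' hσ'
  refine (hw.abs_glauber_pow_mulVec_sub_le_of_mem_leadSet hq hβ hn hP₁ hP₂
    (by positivity) ?_ ?_ ?_ hf _ hσ hσ').trans hle
  · exact (half_le_self hP₁.cutoff_pos.le).trans hcut
  · exact (half_le_self (midLead_pos hn).le).trans hmid
  · linarith

lemma exists_eventually_abs_glauber_pow_mulVec_sub_le {q : ℕ} (hq : 2 < q) {β : ℝ}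
    (hβ : q < β) :
    ∃ (C r : ℝ) (p : ℕ), 0 ≤ C ∧ p ≠ 0 ∧ ∀ γ : ℝ, 0 < γ → ∀ᶠ n : ℕ in atTop, ∀ i : Fin q,
      ∀ f ∈ Set.Icc (0 : Config n q → ℝ) 1,
      ∀ σ ∈ leadSet n i (γ * (n : ℝ) ^ (-(1 / 2) : ℝ)),
      ∀ σ' ∈ leadSet n i (γ * (n : ℝ) ^ (-(1 / 2) : ℝ)),
        |(glauber n q β ^ (3 * phaseTime C n) *ᵥ f) σ -
          (glauber n q β ^ (3 * phaseTime C n) *ᵥ f) σ'| ≤ (2 * q + 1) * (r / γ) ^ p := by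
  obtain ⟨b, a, c, hw⟩ := exists_isGapWindow (by exact_mod_cast hq) hβ
  obtain ⟨p, hp, hcard⟩ := exists_forall_ge_mul_pow_le q hw.c_pos
  have hκ := sub_pos.2 hw.contraction
  exact ⟨max (1 / c) (2 / _), √(8 * p / c), p, le_max_of_le_left (one_div_pos.2 hw.c_pos).le,
    Nat.one_le_iff_ne_zero.1 hp, fun γ hγ =>
      hw.eventually_abs_glauber_pow_mulVec_sub_le (by omega) (q.cast_nonneg.trans hβ.le)
        ((div_le_iff₀' hw.c_pos).1 (le_max_left _ _)) ((div_le_iff₀' hκ).1 (le_max_right _ _))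
        hp hcard hγ⟩

lemma one_div_lt_mr_of_lt {q : ℕ} (hq : 2 < q) {β : ℝ} (hβ : q < β) :
    1 / (q : ℝ) < mr q β := by
  obtain ⟨b, a, c, hw⟩ := exists_isGapWindow (by exact_mod_cast hq) hβ
  have ha : 0 < a := hw.b_pos.trans hw.b_lt_a
  refine one_div_lt_mr (by omega) ha (hw.lt_one (by exact_mod_cast hq.le.trans' one_le_two)) ?_
  nlinarith [hw.expansion a (Set.right_mem_Icc.2 ha.le), mul_pos hw.c_pos ha]

end MixingTime

end Potts

theorem mainTheorem7_general (q : ℕ) (hq : 2 < q) (β : ℝ) (hβ : Potts.betaS q < β) :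
    ∃ (T : ℕ → ℕ) (err : ℝ → ℝ),
      (fun n => (T n : ℝ)) =O[atTop] (fun n : ℕ => (n : ℝ) * Real.log n) ∧
      Tendsto err atTop (𝓝 0) ∧
      ∀ γ : ℝ, 0 < γ → ∀ᶠ n : ℕ in atTop, ∀ i : Fin q,
        ∀ ν ∈ Potts.leadLaws n i (γ * (n : ℝ) ^ (-(1 / 2) : ℝ)),
        ∀ ν' ∈ Potts.leadLaws n i (γ * (n : ℝ) ^ (-(1 / 2) : ℝ)),
          Potts.proportionsTV (Potts.lawAt β ν (T n)) (Potts.lawAt β ν' (T n)) ≤ err γ := by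
  obtain ⟨C, r, p, hC, hp, h⟩ := Potts.exists_eventually_abs_glauber_pow_mulVec_sub_le hq hβ
  refine ⟨fun n => 3 * Potts.phaseTime C n, fun γ => (2 * q + 1) * (r / γ) ^ p, ?_, ?_,
    fun γ hγ => ?_⟩
  · simpa using (Potts.isBigO_phaseTime hC).const_mul_left 3
  · simpa [hp] using (((tendsto_const_nhds (x := r)).div_atTop tendsto_id).pow p).const_mul
      (2 * q + 1 : ℝ)
  · filter_upwards [h γ hγ] with n hn i ν hν ν' hν'
    exact Potts.proportionsTV_lawAt_le hν hν' (hn i)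

theorem mainTheorem7 (q : ℕ) (hq : 2 < q) (β : ℝ) (hβ : Potts.betaS q < β) :
    ∃ (T : ℕ → ℕ) (err : ℝ → ℝ),
      (fun n : ℕ => (T n : ℝ)) =O[atTop] (fun n : ℕ => (n : ℝ) * Real.log n) ∧
      Tendsto err atTop (𝓝 0) ∧
      ∀ (i : Fin q) (r : ℕ → ℝ), Tendsto r atTop (𝓝 0) →
        (∀ᶠ n : ℕ in atTop, (Potts.orderedPhase n q β i (r n)).Nonempty) →
        ∀ γ : ℝ, 0 < γ → ∀ᶠ n : ℕ in atTop, ∀ σ₀ : Potts.Config n q,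
          (∀ j : Fin q, j ≠ i →
            Potts.proportions σ₀ i > Potts.proportions σ₀ j + γ * (n : ℝ) ^ (-(1 / 2) : ℝ)) →
          Potts.proportionsTV
              (Potts.lawAt β (Potts.pointMass σ₀) (T n))
              (Potts.lawAt β (Potts.gibbsOrdered n q β i (r n)) (T n)) ≤ err γ := by
  obtain ⟨T, err, hT, herr, h⟩ := mainTheorem7_general q hq β hβ
  refine ⟨T, err, hT, herr, fun i r hr hne γ hγ => ?_⟩
  have hlead : Tendsto (fun n : ℕ => γ * (n : ℝ) ^ (-(1 / 2) : ℝ)) atTop (𝓝 0) := by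
    simpa using (Potts.tendsto_rpow_neg_natCast one_half_pos).const_mul γ
  filter_upwards [h γ hγ, Potts.eventually_gibbsOrdered_mem_leadLaws (by omega)
    (Potts.one_div_lt_mr_of_lt hq hβ) i hr hlead hne] with n hn hordered σ₀ hσ₀
  exact hn i _ (Potts.pointMass_mem_leadLaws fun j hj => (lt_sub_iff_add_lt'.2 (hσ₀ j hj)).le) _
    hordered
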